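/- Let $a,b,c\in\mathbb R$ with $a^2\ge 0$, $b^2,c^2>0$, let $k\in\mathbb Z\setminus\{0\}$ and $R\in(0,\infty]$, and put $$s_+=\frac{b^2+\sqrt{b^4+24a^2c^2}}{4c^2}.$$ Let $(u,v)$ be any solution (twice differentiable on $(0,R)$) of $$u''+\frac{u'}{r}-\frac{k^2u}{r^2}=u\Big[-a^2+\sqrt{\tfrac23}\,b^2v+c^2(u^2+v^2)\Big],$$ $$v''+\frac{v'}{r}=v\Big[-a^2-\tfrac1{\sqrt6}b^2v+c^2(u^2+v^2)\Big]+\tfrac1{\sqrt6}b^2u^2\qquad\text{on }(0,R),$$ under the boundary conditions $$u(0)=0,\quad v'(0)=0,\quad u(R)=\tfrac1{\sqrt2}s_+,\quad v(R)=-\tfrac1{\sqrt6}s_+,$$ where $u$ is continuous at $0$ from the right, $v'(0)$ is the one-sided derivative, and the conditions at $R$ mean limits as $r\to R$, $r<R$ (that is, as $r\to\infty$ if $R=\infty$). Assume that $u>0$ and $v<0$ on $(0,R)$. Then: - $u'>0$ on $(0,R)$; - if $b^4<3a^2c^2$, then $v'>0$ on $(0,R)$; - if $b^4=3a^2c^2$,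 then $v\equiv-\frac{s_+}{\sqrt6}$ on $(0,R)$; - if $b^4>3a^2c^2$, then $v'<0$ on $(0,R)$. -/

import Mathlib

open Filter Topology

noncomputable section

namespace LdG

/-- The scalar order parameter `s₊` of the bulk minimizers. -/
def sPlus (a b c : ℝ) : ℝ :=
  (b ^ 2 + Real.sqrt (b ^ 4 + 24 * a ^ 2 * c ^ 2)) / (4 * c ^ 2)

/-- The right-hand side of the first equation. -/
def hFun (a b c p q : ℝ) : ℝ :=
  p * (-a ^ 2 + Real.sqrt (2 / 3) * b ^ 2 * q + c ^ 2 * (p ^ 2 + q ^ 2))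

/-- The right-hand side of the second equation. -/
def gFun (a b c p q : ℝ) : ℝ :=
  q * (-a ^ 2 - 1 / Real.sqrt 6 * b ^ 2 * q + c ^ 2 * (p ^ 2 + q ^ 2))
    + 1 / Real.sqrt 6 * b ^ 2 * p ^ 2

/-- The open interval `(0, R)`, where `R` may be infinite. -/
def interval (R : EReal) : Set ℝ := {r : ℝ | 0 < r ∧ (r : EReal) < R}

/-- The filter `r → R` from inside `(0, R)`: left neighbourhoods of `R` if `R` is finite,
neighbourhoods of `+∞` if `R = ∞` (used for `0 < R` only). -/
def endFilter (R : EReal) : Filter ℝ :=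
  if R = ⊤ then atTop else 𝓝[<] R.toReal

/-- `(u, v)` is a classical (twice differentiable) solution on `(0, R)` of
`u'' + u'/r - k²u/r² = h(u,v)`, `v'' + v'/r = g(u,v)`. Such a solution is automatically `C²`. -/
structure IsSolution (a b c : ℝ) (k : ℤ) (R : EReal) (u v : ℝ → ℝ) : Prop where
  diff_u : ∀ r ∈ interval R, DifferentiableAt ℝ u r
  diff_v : ∀ r ∈ interval R, DifferentiableAt ℝ v r
  diff_deriv_u : ∀ r ∈ interval R, DifferentiableAt ℝ (deriv u) r
  diff_deriv_v : ∀ r ∈ interval R, DifferentiableAt ℝ (deriv v) r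
  eq_u : ∀ r ∈ interval R,
    deriv (deriv u) r + deriv u r / r - (k : ℝ) ^ 2 * u r / r ^ 2 = hFun a b c (u r) (v r)
  eq_v : ∀ r ∈ interval R,
    deriv (deriv v) r + deriv v r / r = gFun a b c (u r) (v r)

/-- The boundary conditions `u(0) = 0`, `v'(0) = 0` (one-sided derivative),
`u(R) = s₊/√2`, `v(R) = -s₊/√6`, the last two as limits `r → R` from inside `(0, R)`. -/
structure BoundaryConditions (a b c : ℝ) (R : EReal) (u v : ℝ → ℝ) : Prop where
  u_zero : u 0 = 0
  cont_u_zero : ContinuousWithinAt u (Set.Ici 0) 0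
  deriv_v_zero : HasDerivWithinAt v 0 (Set.Ici 0) 0
  u_end : Tendsto u (endFilter R) (𝓝 (1 / Real.sqrt 2 * sPlus a b c))
  v_end : Tendsto v (endFilter R) (𝓝 (-(1 / Real.sqrt 6) * sPlus a b c))

end LdG

end

/-!
The idea is to write the system, in the regime at hand, as a cooperative radial system for `u` and
`z = ±v`, and to run a one-dimensional version of the method of moving planes.

*Reduced form.* With `σ = s₊/√6`, `β = b²/(√6 c²)`, the sign of `3a²c² - b⁴` is that of `σ - β`,
and the nonlinearities become `hRed` and `gRed`. The derivative of the first in `v` and of the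
second in `u` have the sign of `v + β`. The maximum principle (`nonpos_of_radial_subharmonic`) gives
`u² + v² ≤ 4σ²`, then `v < -σ` if `β < σ`, `v > -σ` if `β > σ`, and `v = -σ` if `β = σ`, and finally
`u < √3 σ`. So `v + β < 0` in the first regime and `v + β > 0` in the second: the system is
cooperative for `(u, v)` and `(u, -v)` respectively, and each unknown lies strictly below its
boundary value at `R`. For `β = σ` the equation of `u` decouples.

*Monotonicity.* `OrderedAcross R f m` says `f s ≤ f r` whenever `s < r` and `s + r ≥ m`. The
two-point function `f r - f s` plays the role of the difference between a function and its reflection: at a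
minimum along `s + r = const` the first-order condition `f' r = -f' s` gives the terms `f'/r` a
favourable sign, the term `-κ f/r²` is monotone in `r`, and cooperativity takes care of the
nonlinearity (`CoopComponent.deriv_mul_le_of_isLocalMin`). The ordering holds for reflections close
to `R`, since the linearization at the boundary state maps some positive vector to a positive vector
(`exists_orderedAcross`). It continues down to `m = 0`: at a positive critical `m` a touching point
off the diagonal is excluded by the two-point comparison, and a vanishing slope on the diagonal by a
Hopf lemma (`eq_zero_of_second_order_ineq`), so that by compactness `m` can be decreased
(`CoopComponent.exists_orderedAcross_lt`). The same Hopf lemma makes the derivatives strictly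
positive (`deriv_pos_of_coopComponent`).
-/

open Filter Topology

noncomputable section

namespace LdG

/-! ### One-variable calculus -/

lemma nonneg_second_deriv_of_isLocalMin {f f' : ℝ → ℝ} {c x : ℝ} (hmin : IsLocalMin f x)
    (h1 : ∀ᶠ y in 𝓝 x, HasDerivAt f (f' y) y) (h2 : HasDerivAt f' c x) : 0 ≤ c := by
  by_contra! hc
  have e : deriv f =ᶠ[𝓝 x] f' := h1.mono fun y hy => hy.deriv
  have d2 : deriv (deriv f) x = c := by rw [e.deriv_eq]; exact h2.deriv
  -- If `c < 0`, then `x` is also a local maximum, so `f` is constant near `x` and `c = 0`.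
  have hmax := isLocalMax_of_deriv_deriv_neg (by rw [d2]; exact hc) hmin.deriv_eq_zero
    h1.self_of_nhds.continuousAt
  have const : f =ᶠ[𝓝 x] fun _ => f x := by
    filter_upwards [hmin, hmax] with y a b
    exact le_antisymm b a
  have h0 : deriv (deriv f) x = 0 := by
    rw [const.deriv.deriv_eq]; simp
  linarith

lemma nonneg_of_hasDerivWithinAt_Ici {f : ℝ → ℝ} {c x : ℝ}
    (h : HasDerivWithinAt f c (Set.Ici x) x) (hf : ∀ᶠ y in 𝓝[>] x, f x ≤ f y) : 0 ≤ c := by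
  have h' : Tendsto (slope f x) (𝓝[>] x) (𝓝 c) := by
    have := hasDerivWithinAt_iff_tendsto_slope.1 h
    rwa [Set.Ici_sdiff_left] at this
  refine ge_of_tendsto h' ?_
  filter_upwards [hf, self_mem_nhdsWithin] with y hy hxy
  rw [slope_def_field]
  exact div_nonneg (sub_nonneg.2 hy) (sub_nonneg.2 (le_of_lt hxy))

lemma nonpos_of_deriv_nonpos_where_pos {e e' : ℝ → ℝ} {a b : ℝ}
    (hd : ∀ x ∈ Set.Icc a b, HasDerivAt e (e' x) x) (ha : e a ≤ 0)
    (hneg : ∀ x ∈ Set.Ioo a b, 0 < e x → e' x ≤ 0) :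
    ∀ x ∈ Set.Icc a b, e x ≤ 0 := by
  intro x1 hx1
  by_contra! hpos
  have hc : ContinuousOn e (Set.Icc a x1) := fun x hx =>
    (hd x ⟨hx.1, hx.2.trans hx1.2⟩).continuousAt.continuousWithinAt
  -- Beyond the last zero `x0` of `e` before `x1`, `e` is positive, hence nonincreasing.
  have hcomp : IsCompact (Set.Icc a x1 ∩ e ⁻¹' Set.Iic 0) :=
    isCompact_Icc.of_isClosed_subset (hc.preimage_isClosed_of_isClosed isClosed_Icc isClosed_Iic)
      Set.inter_subset_left
  obtain ⟨x0, ⟨⟨h0a, h01⟩, h0⟩, hmax⟩ := hcomp.exists_isGreatest ⟨a, ⟨le_rfl, hx1.1⟩, ha⟩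
  have h0' : e x0 ≤ 0 := h0
  have hanti : AntitoneOn e (Set.Icc x0 x1) := by
    refine antitoneOn_of_deriv_nonpos (convex_Icc _ _) (hc.mono (Set.Icc_subset_Icc_left h0a)) ?_ ?_
    · intro x hx
      rw [interior_Icc] at hx
      exact (hd x ⟨h0a.trans hx.1.le, hx.2.le.trans hx1.2⟩).differentiableAt.differentiableWithinAt
    · intro x hx
      rw [interior_Icc] at hx
      rw [(hd x ⟨h0a.trans hx.1.le, hx.2.le.trans hx1.2⟩).deriv]
      refine hneg x ⟨lt_of_le_of_lt h0a hx.1, lt_of_lt_of_le hx.2 hx1.2⟩ ?_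
      by_contra! hle
      exact absurd (hmax ⟨⟨h0a.trans hx.1.le, hx.2.le⟩, hle⟩) (not_le.2 hx.1)
  have := hanti ⟨le_rfl, h01⟩ ⟨h01, le_rfl⟩ h01
  linarith

/-- A one-dimensional Hopf boundary lemma: a nonnegative solution of the differential inequality
`D'' ≤ C D' + K D` with zero initial value and slope vanishes. -/
lemma eq_zero_of_second_order_ineq {D D1 D2 : ℝ → ℝ} {ε C K : ℝ} (hC : 0 ≤ C) (hK : 0 ≤ K)
    (h1 : ∀ t ∈ Set.Icc 0 ε, HasDerivAt D (D1 t) t)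
    (h2 : ∀ t ∈ Set.Icc 0 ε, HasDerivAt D1 (D2 t) t)
    (hD : ∀ t ∈ Set.Icc 0 ε, 0 ≤ D t) (hD0 : D 0 = 0) (hD10 : D1 0 = 0)
    (hineq : ∀ t ∈ Set.Ioo 0 ε, 0 ≤ D1 t → D2 t ≤ C * D1 t + K * D t) :
    ∀ t ∈ Set.Icc 0 ε, D t = 0 := by
  -- With `κ² ≥ C κ + K`, the quantity `D' - κ D` is nonincreasing where positive.
  set κ := C + K + 1 with hκ
  have he : ∀ t ∈ Set.Icc 0 ε, D1 t - κ * D t ≤ 0 := by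
    refine nonpos_of_deriv_nonpos_where_pos (e' := fun t => D2 t - κ * D1 t)
      (fun t ht => (h2 t ht).sub ((h1 t ht).const_mul κ)) (by simp [hD0, hD10]) ?_
    intro t ht hpos
    have hDt := hD t ⟨ht.1.le, ht.2.le⟩
    have hκD : 0 ≤ κ * D t := by positivity
    have h := hineq t ht (by linarith)
    have h3 : 0 ≤ (K + 1) * (D1 t - κ * D t) := mul_nonneg (by linarith) hpos.le
    have h4 : 0 ≤ (K + 1) * (C + K) * D t := by positivity
    simp only [hκ] at *
    nlinarith
  have hexp : ∀ t ∈ Set.Icc 0 ε, D t * Real.exp (-κ * t) ≤ 0 := by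
    refine nonpos_of_deriv_nonpos_where_pos
      (e' := fun t => D1 t * Real.exp (-κ * t) + D t * (Real.exp (-κ * t) * (-κ * 1)))
      (fun t ht => (h1 t ht).mul ((hasDerivAt_id t).const_mul (-κ)).exp) (by simp [hD0]) ?_
    intro t ht _
    have := mul_nonneg (sub_nonneg.2 (he t ⟨ht.1.le, ht.2.le⟩)) (Real.exp_pos (-κ * t)).le
    linarith
  intro t ht
  refine le_antisymm ?_ (hD t ht)
  by_contra! hpos
  exact absurd (hexp t ht) (not_le.2 (mul_pos hpos (Real.exp_pos _)))

/-- A function that is subharmonic on a punctured disc, radial, and bounded near the centre is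
radially nondecreasing: a negative flux `r w'` would force logarithmic blow-up at `0`. -/
lemma deriv_nonneg_of_radial_subharmonic {w w1 w2 : ℝ → ℝ} {ε : ℝ}
    (h1 : ∀ r ∈ Set.Ioo 0 ε, HasDerivAt w (w1 r) r)
    (h2 : ∀ r ∈ Set.Ioo 0 ε, HasDerivAt w1 (w2 r) r)
    (h0 : ContinuousWithinAt w (Set.Ici 0) 0)
    (hsub : ∀ r ∈ Set.Ioo 0 ε, 0 ≤ w2 r + w1 r / r) :
    ∀ r ∈ Set.Ioo 0 ε, 0 ≤ w1 r := by
  intro r1 hr1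
  by_contra! hneg
  have hflux : MonotoneOn (fun r => r * w1 r) (Set.Ioo 0 ε) := by
    have hd : ∀ r ∈ Set.Ioo 0 ε, HasDerivAt (fun r => r * w1 r) (1 * w1 r + r * w2 r) r :=
      fun r hr => (hasDerivAt_id r).mul (h2 r hr)
    refine monotoneOn_of_deriv_nonneg (convex_Ioo _ _)
      (fun r hr => (hd r hr).continuousAt.continuousWithinAt) ?_ ?_
    · intro r hr
      rw [interior_Ioo] at hr
      exact (hd r hr).differentiableAt.differentiableWithinAt
    · intro r hr
      rw [interior_Ioo] at hr
      rw [(hd r hr).deriv]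
      have h := mul_nonneg hr.1.le (hsub r hr)
      have : r * (w2 r + w1 r / r) = 1 * w1 r + r * w2 r := by
        field_simp [hr.1.ne']
        ring
      linarith
  set c := -(r1 * w1 r1) with hc
  have hcpos : 0 < c := by
    have := mul_pos hr1.1 (neg_pos.2 hneg)
    simp only [hc]; linarith
  have hd : ∀ r ∈ Set.Ioc 0 r1, HasDerivAt (fun r => w r + c * Real.log r) (w1 r + c * r⁻¹) r :=
    fun r hr => (h1 r ⟨hr.1, hr.2.trans_lt hr1.2⟩).add ((Real.hasDerivAt_log hr.1.ne').const_mul c)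
  have hanti : AntitoneOn (fun r => w r + c * Real.log r) (Set.Ioc 0 r1) := by
    refine antitoneOn_of_deriv_nonpos (convex_Ioc _ _)
      (fun r hr => (hd r hr).continuousAt.continuousWithinAt) ?_ ?_
    · intro r hr
      rw [interior_Ioc] at hr
      exact (hd r ⟨hr.1, hr.2.le⟩).differentiableAt.differentiableWithinAt
    · intro r hr
      rw [interior_Ioc] at hr
      rw [(hd r ⟨hr.1, hr.2.le⟩).deriv]
      have h := hflux ⟨hr.1, hr.2.trans hr1.2⟩ hr1 hr.2.le
      have h' : r * w1 r ≤ -c := by simp only [hc]; simpa using h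
      have : w1 r + c * r⁻¹ = (r * w1 r + c) * r⁻¹ := by
        field_simp [hr.1.ne']
      rw [this]
      exact mul_nonpos_of_nonpos_of_nonneg (by linarith) (inv_nonneg.2 hr.1.le)
  have hbot : Tendsto (fun r => w r + c * Real.log r) (𝓝[>] 0) atBot :=
    (h0.mono_left (nhdsWithin_mono _ Set.Ioi_subset_Ici_self)).add_atBot
      (Real.tendsto_log_nhdsGT_zero.const_mul_atBot hcpos)
  have hev := hbot.eventually (eventually_lt_atBot (w r1 + c * Real.log r1))
  obtain ⟨r, hr, hmem⟩ := (hev.and (Ioo_mem_nhdsGT hr1.1)).exists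
  have := hanti ⟨hmem.1, hmem.2.le⟩ ⟨hr1.1, le_rfl⟩ hmem.2.le
  simp only at this
  linarith

/-! ### The interval `(0, R)` and the maximum principle -/

lemma isOpen_interval (R : EReal) : IsOpen (interval R) :=
  isOpen_Ioi.inter (isOpen_Iio.preimage continuous_coe_real_ereal)

lemma interval_of_le {R : EReal} {r s : ℝ} (hr : r ∈ interval R) (hs : 0 < s) (h : s ≤ r) :
    s ∈ interval R :=
  ⟨hs, lt_of_le_of_lt (EReal.coe_le_coe_iff.2 h) hr.2⟩

lemma exists_lt_mem_interval {R : EReal} {r : ℝ} (hr : r ∈ interval R) :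
    ∃ s ∈ interval R, r < s := by
  obtain ⟨q, h1, h2⟩ := EReal.lt_iff_exists_real_btwn.1 hr.2
  have := EReal.coe_lt_coe_iff.1 h1
  exact ⟨q, ⟨hr.1.trans this, h2⟩, this⟩

lemma exists_of_eventually_endFilter {R : EReal} (hR : 0 < R) {P : ℝ → Prop}
    (h : ∀ᶠ r in endFilter R, P r) : ∃ S ∈ interval R, ∀ r ∈ interval R, S < r → P r := by
  unfold endFilter at h
  split_ifs at h with hT
  · subst hT
    obtain ⟨S, hS⟩ := eventually_atTop.1 h
    exact ⟨max S 1, ⟨by positivity, EReal.coe_lt_top _⟩, fun r _ hr =>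
      hS r ((le_max_left _ _).trans hr.le)⟩
  · obtain ⟨ρ, rfl⟩ : ∃ ρ : ℝ, R = ρ := ⟨R.toReal, (EReal.coe_toReal hT (ne_bot_of_gt hR)).symm⟩
    rw [EReal.toReal_coe] at h
    have hpos : 0 < ρ := by exact_mod_cast hR
    obtain ⟨l, hl, hsub⟩ := (mem_nhdsLT_iff_exists_Ioo_subset' hpos).1 h
    have hl' : l < ρ := hl
    refine ⟨max l (ρ / 2), ⟨by positivity, EReal.coe_lt_coe_iff.2 (max_lt hl' (by linarith))⟩,
      fun r hr hlr => hsub ⟨(le_max_left _ _).trans_lt hlr, EReal.coe_lt_coe_iff.1 hr.2⟩⟩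

lemma exists_mem_interval {R : EReal} (hR : 0 < R) : ∃ S, S ∈ interval R :=
  let ⟨S, hS, _⟩ := exists_of_eventually_endFilter hR (P := fun _ => True) (by simp)
  ⟨S, hS⟩

lemma continuousOn_Icc_of_mem_interval {R : EReal} {f : ℝ → ℝ}
    (hf : ∀ r ∈ interval R, ContinuousAt f r) (h0 : ContinuousWithinAt f (Set.Ici 0) 0)
    {S : ℝ} (hS : S ∈ interval R) : ContinuousOn f (Set.Icc 0 S) := by
  intro r hr
  rcases hr.1.eq_or_lt with h | h
  · subst h; exact h0.mono fun x hx => hx.1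
  · exact (hf r (interval_of_le hS h hr.2)).continuousWithinAt

/-- Weak maximum principle for radial functions on the disc of radius `R`; the centre needs no
boundary condition besides continuity. -/
lemma nonpos_of_radial_subharmonic {R : EReal} (hR : 0 < R) {w w1 w2 : ℝ → ℝ} {l : ℝ}
    (h1 : ∀ r ∈ interval R, HasDerivAt w (w1 r) r)
    (h2 : ∀ r ∈ interval R, HasDerivAt w1 (w2 r) r)
    (h0 : ContinuousWithinAt w (Set.Ici 0) 0)
    (hl : Tendsto w (endFilter R) (𝓝 l)) (hl0 : l ≤ 0)
    (hsub : ∀ r ∈ interval R, 0 < w r → 0 < w2 r + w1 r / r) :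
    ∀ r ∈ interval R, w r ≤ 0 := by
  intro r0 hr0
  by_contra! hpos
  obtain ⟨S, hS, hSw⟩ := exists_of_eventually_endFilter hR
    (hl.eventually (gt_mem_nhds (lt_of_le_of_lt hl0 hpos)))
  obtain ⟨S', hS', hSS⟩ : ∃ S' ∈ interval R, max r0 S < S' := by
    apply exists_lt_mem_interval
    rcases max_choice r0 S with h | h <;> rw [h] <;> assumption
  have hcont := continuousOn_Icc_of_mem_interval (fun r hr => (h1 r hr).continuousAt) h0 hS'
  have hr0S : r0 < S' := (le_max_left _ _).trans_lt hSS
  obtain ⟨x, hx, hmax⟩ := isCompact_Icc.exists_isMaxOn ⟨r0, hr0.1.le, hr0S.le⟩ hcont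
  have hwx : w r0 ≤ w x := hmax ⟨hr0.1.le, hr0S.le⟩
  have hxS : x < S' := by
    by_contra! h
    have hxe : x = S' := le_antisymm hx.2 h
    have := hSw S' hS' ((le_max_right _ _).trans_lt hSS)
    rw [← hxe] at this
    linarith
  rcases hx.1.eq_or_lt with hx0 | hx0
  · -- The maximum at the centre: `w` is nondecreasing near `0`, hence constant, hence harmonic.
    have hev : ∀ᶠ r in 𝓝[≥] (0 : ℝ), 0 < w r :=
      h0.eventually (lt_mem_nhds (by rw [hx0]; linarith))
    obtain ⟨ε, hε, hεw⟩ := (mem_nhdsGE_iff_exists_Ico_subset' hS'.1).1 hev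
    have hε' : 0 < ε := hε
    set δ := min ε S'
    have hδ : 0 < δ := lt_min hε' hS'.1
    have hI : ∀ r ∈ Set.Ioo 0 δ, r ∈ interval R := fun r hr =>
      interval_of_le hS' hr.1 (hr.2.le.trans (min_le_right _ _))
    have hlap : ∀ r ∈ Set.Ioo 0 δ, 0 < w2 r + w1 r / r := fun r hr =>
      hsub r (hI r hr) (hεw ⟨hr.1.le, hr.2.trans_le (min_le_left _ _)⟩)
    have hmono := deriv_nonneg_of_radial_subharmonic (fun r hr => h1 r (hI r hr))
      (fun r hr => h2 r (hI r hr)) h0 (fun r hr => (hlap r hr).le)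
    have hmon : MonotoneOn w (Set.Ico 0 δ) := by
      refine monotoneOn_of_deriv_nonneg (convex_Ico _ _) (hcont.mono fun r hr =>
        ⟨hr.1, hr.2.le.trans (min_le_right _ _)⟩) ?_ ?_
      · intro r hr
        rw [interior_Ico] at hr
        exact (h1 r (hI r hr)).differentiableAt.differentiableWithinAt
      · intro r hr
        rw [interior_Ico] at hr
        rw [(h1 r (hI r hr)).deriv]
        exact hmono r hr
    have hconst : ∀ r ∈ Set.Ioo 0 δ, w r = w 0 := fun r hr => le_antisymm
      (by rw [hx0]; exact hmax ⟨hr.1.le, hr.2.le.trans (min_le_right _ _)⟩)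
      (hmon ⟨le_rfl, hδ⟩ ⟨hr.1.le, hr.2⟩ hr.1.le)
    have hw1 : ∀ r ∈ Set.Ioo 0 δ, w1 r = 0 := fun r hr => by
      have he : w =ᶠ[𝓝 r] fun _ => w 0 := by
        filter_upwards [isOpen_Ioo.mem_nhds hr] with y hy using hconst y hy
      rw [← (h1 r (hI r hr)).deriv, he.deriv_eq]; simp
    have hm : δ / 2 ∈ Set.Ioo 0 δ := ⟨by linarith, by linarith⟩
    have hw2 : w2 (δ / 2) = 0 := by
      have he : w1 =ᶠ[𝓝 (δ / 2)] fun _ => 0 := by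
        filter_upwards [isOpen_Ioo.mem_nhds hm] with y hy using hw1 y hy
      rw [← (h2 _ (hI _ hm)).deriv, he.deriv_eq]; simp
    have := hlap _ hm
    rw [hw2, hw1 _ hm] at this
    simp at this
  · have hxI := interval_of_le hS' hx0 hx.2
    have hloc : IsLocalMax w x := by
      filter_upwards [isOpen_Ioo.mem_nhds (show x ∈ Set.Ioo 0 S' from ⟨hx0, hxS⟩)] with y hy
      exact hmax ⟨hy.1.le, hy.2.le⟩
    have hz : w1 x = 0 := hloc.hasDerivAt_eq_zero (h1 x hxI)
    have h2' : 0 ≤ -w2 x := by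
      refine nonneg_second_deriv_of_isLocalMin hloc.neg (f' := fun y => -w1 y) ?_ (h2 x hxI).neg
      filter_upwards [(isOpen_interval R).mem_nhds hxI] with y hy using (h1 y hy).neg
    have := hsub x hxI (by linarith)
    rw [hz] at this
    simp at this
    linarith

/-! ### Cooperative radial systems -/

/-- `f` is a component of a cooperative radial system on `(0, R)` whose other component is `g`:
`f'' + f'/r - κ f/r² = F(f, g)`, where `F` is nonincreasing in its second argument along the
solution (`anti`) and one-sided Lipschitz in its first (`lip`), with `f` strictly below its limit
`L` at `R`. The field `centre` is a condition at `0` that suits both `u` and `v`. The field `end_neg`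
says that near `R` the nonlinearity decreases strictly along decrements dominated by the direction
`(φ, ψ)`; it holds when the linearization at the limit state maps the positive vector `(φ, ψ)` to a
positive vector. -/
structure CoopComponent (R : EReal) (κ : ℝ) (F : ℝ → ℝ → ℝ) (f g : ℝ → ℝ) (L φ ψ : ℝ) :
    Prop where
  diff : ∀ r ∈ interval R, DifferentiableAt ℝ f r
  diff_deriv : ∀ r ∈ interval R, DifferentiableAt ℝ (deriv f) r
  eq : ∀ r ∈ interval R,
    deriv (deriv f) r + deriv f r / r - κ * f r / r ^ 2 = F (f r) (g r)
  coeff_nonneg : 0 ≤ κ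
  mul_nonneg : ∀ r ∈ interval R, 0 ≤ κ * f r
  cont_zero : ContinuousWithinAt f (Set.Ici 0) 0
  centre : (∀ r ∈ interval R, f 0 < f r) ∨ HasDerivWithinAt f 0 (Set.Ici 0) 0
  lim : Tendsto f (endFilter R) (𝓝 L)
  lt_zero : f 0 < L
  lt : ∀ r ∈ interval R, f r < L
  anti : ∀ a ∈ interval R, ∀ b ∈ interval R, ∀ c ∈ interval R,
    g c ≤ g b → F (f a) (g b) ≤ F (f a) (g c)
  lip : ∃ K, 0 ≤ K ∧ ∀ a ∈ interval R, ∀ b ∈ interval R, ∀ c ∈ interval R,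
    f b ≤ f a → F (f a) (g c) - F (f b) (g c) ≤ K * (f a - f b)
  pos_weight : 0 < φ
  end_neg : ∃ S ∈ interval R, ∀ a ∈ interval R, ∀ b ∈ interval R, S < a → S < b → ∀ δ > 0,
    f a - f b = -(δ * φ) → -(δ * ψ) ≤ g a - g b → F (f a) (g a) < F (f b) (g b)

/-- `f s ≤ f r` for all `0 ≤ s < r < R` whose midpoint is at least `m / 2`. For `m = 0` this is
monotonicity; decreasing `m` is the one-dimensional analogue of moving a reflection plane. -/
def OrderedAcross (R : EReal) (f : ℝ → ℝ) (m : ℝ) : Prop :=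
  ∀ s r, 0 ≤ s → s < r → r ∈ interval R → m ≤ s + r → f s ≤ f r

lemma OrderedAcross.mono {R : EReal} {f : ℝ → ℝ} {m m' : ℝ} (h : OrderedAcross R f m)
    (hm : m ≤ m') : OrderedAcross R f m' :=
  fun s r h0 hs hr hsum => h s r h0 hs hr (hm.trans hsum)

lemma max_mem_interval {R : EReal} {r s : ℝ} (hr : r ∈ interval R) (hs : s ∈ interval R) :
    max r s ∈ interval R := by
  rcases max_choice r s with h | h <;> rw [h] <;> assumption

lemma eventually_reflected {R : EReal} {s r : ℝ} (hs : 0 < s) (hsr : s < r)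
    (hr : r ∈ interval R) :
    ∀ᶠ t in 𝓝 (0 : ℝ), 0 < s - t ∧ s - t < r + t ∧ s - t ∈ interval R ∧ r + t ∈ interval R := by
  have c1 : Tendsto (fun t : ℝ => s - t) (𝓝 0) (𝓝 s) := by
    have : Continuous fun t : ℝ => s - t := by fun_prop
    simpa using this.tendsto 0
  have c2 : Tendsto (fun t : ℝ => r + t) (𝓝 0) (𝓝 r) := by
    have : Continuous fun t : ℝ => r + t := by fun_prop
    simpa using this.tendsto 0
  filter_upwards [c1.eventually (lt_mem_nhds hs), c1.eventually_lt c2 hsr,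
    c1.eventually ((isOpen_interval R).mem_nhds (interval_of_le hr hs hsr.le)),
    c2.eventually ((isOpen_interval R).mem_nhds hr)] with t h1 h2 h3 h4
  exact ⟨h1, h2, h3, h4⟩

namespace CoopComponent

variable {R : EReal} {κ L φ ψ : ℝ} {F : ℝ → ℝ → ℝ} {f g : ℝ → ℝ}

lemma continuousAt (C : CoopComponent R κ F f g L φ ψ) {r : ℝ} (hr : r ∈ interval R) :
    ContinuousAt f r := (C.diff r hr).continuousAt

lemma continuousOn (C : CoopComponent R κ F f g L φ ψ) {S : ℝ} (hS : S ∈ interval R) :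
    ContinuousOn f (Set.Icc 0 S) :=
  continuousOn_Icc_of_mem_interval (fun _ hr => C.continuousAt hr) C.cont_zero hS

lemma lt_of_nonneg (C : CoopComponent R κ F f g L φ ψ) {s r : ℝ} (h0 : 0 ≤ s) (hs : s ≤ r)
    (hr : r ∈ interval R) : f s < L := by
  rcases h0.eq_or_lt with h | h
  · rw [← h]; exact C.lt_zero
  · exact C.lt s (interval_of_le hr h hs)

lemma exists_forall_lt (C : CoopComponent R κ F f g L φ ψ) (hR : 0 < R) {S : ℝ}
    (hS : S ∈ interval R) :
    ∃ S' ∈ interval R, ∀ r ∈ interval R, S' < r → ∀ s ∈ Set.Icc 0 S, f s < f r := by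
  obtain ⟨x, hx, hmax⟩ := isCompact_Icc.exists_isMaxOn ⟨0, le_rfl, hS.1.le⟩ (C.continuousOn hS)
  obtain ⟨S', hS', h⟩ := exists_of_eventually_endFilter hR
    (C.lim.eventually (lt_mem_nhds (C.lt_of_nonneg hx.1 hx.2 hS)))
  exact ⟨S', hS', fun r hr hlt s hs => (hmax hs).trans_lt (h r hr hlt)⟩

lemma deriv_nonneg (C : CoopComponent R κ F f g L φ ψ) {m r : ℝ} (h : OrderedAcross R f m)
    (hr : r ∈ interval R) (hm : m ≤ 2 * r) : 0 ≤ deriv f r := by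
  refine nonneg_of_hasDerivWithinAt_Ici (C.diff r hr).hasDerivAt.hasDerivWithinAt ?_
  filter_upwards [self_mem_nhdsWithin,
    mem_nhdsWithin_of_mem_nhds ((isOpen_interval R).mem_nhds hr)] with y hy hyI
  have hy' : r < y := hy
  exact h r y hr.1.le hy' hyI (by linarith)

/-- First- and second-order conditions at a minimum of the two-point function `f r - f s` along
reflection. The first-order condition turns the two first-order terms of the equations into
terms of equal sign. -/
lemma deriv_mul_le_of_isLocalMin (C : CoopComponent R κ F f g L φ ψ) {s r : ℝ} (hs : 0 < s)
    (hsr : s < r) (hr : r ∈ interval R) (hfr : f r ≤ f s)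
    (hmin : IsLocalMin (fun t => f (r + t) - f (s - t)) 0) :
    deriv f r * (1 / r + 1 / s) ≤ F (f r) (g r) - F (f s) (g s) := by
  have hsI := interval_of_le hr hs hsr.le
  have hd : ∀ᶠ t in 𝓝 (0 : ℝ), HasDerivAt (fun t => f (r + t) - f (s - t))
      (deriv f (r + t) + deriv f (s - t)) t := by
    filter_upwards [eventually_reflected hs hsr hr] with t ht
    have := ((C.diff _ ht.2.2.2).hasDerivAt.comp_const_add r t).fun_sub
      ((C.diff _ ht.2.2.1).hasDerivAt.comp_const_sub s t)
    simpa using this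
  have hd2 : HasDerivAt (fun t => deriv f (r + t) + deriv f (s - t))
      (deriv (deriv f) r - deriv (deriv f) s) 0 := by
    have h1 : HasDerivAt (deriv f) (deriv (deriv f) r) (r + 0) := by
      rw [add_zero]; exact (C.diff_deriv r hr).hasDerivAt
    have h2 : HasDerivAt (deriv f) (deriv (deriv f) s) (s - 0) := by
      rw [sub_zero]; exact (C.diff_deriv s hsI).hasDerivAt
    have := (h1.comp_const_add r 0).fun_add (h2.comp_const_sub s 0)
    simpa [sub_eq_add_neg] using this
  have hzero : deriv f r + deriv f s = 0 := by
    have := hmin.hasDerivAt_eq_zero hd.self_of_nhds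
    simpa using this
  have hsec := nonneg_second_deriv_of_isLocalMin hmin hd hd2
  have er := C.eq r hr
  have es := C.eq s hsI
  have hk : κ * f r / r ^ 2 ≤ κ * f s / s ^ 2 :=
    div_le_div₀ (C.mul_nonneg s hsI) (mul_le_mul_of_nonneg_left hfr C.coeff_nonneg)
      (pow_pos hs 2) (pow_le_pow_left₀ hs.le hsr.le 2)
  have hs' : deriv f s = -deriv f r := by linarith
  have e1 : deriv f s / s = -(deriv f r * (1 / s)) := by rw [hs']; ring
  have e2 : deriv f r / r = deriv f r * (1 / r) := by ring
  rw [e1] at es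
  rw [e2] at er
  rw [mul_add]
  linarith

/-- If the slope vanishes at the point of reflection, then `f` is symmetric about it
nearby: the difference of `f` and its reflection has zero value and slope there. -/
lemma eq_reflection_of_deriv_eq_zero (C : CoopComponent R κ F f g L φ ψ) {x : ℝ}
    (hx : x ∈ interval R) (hf : OrderedAcross R f (2 * x)) (hg : OrderedAcross R g (2 * x))
    (h0 : deriv f x = 0) :
    ∃ ε > 0, ε < x ∧ x + ε ∈ interval R ∧ ∀ t ∈ Set.Icc 0 ε, f (x + t) = f (x - t) := by
  obtain ⟨y, hy, hxy⟩ := exists_lt_mem_interval hx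
  obtain ⟨K, hK0, hK⟩ := C.lip
  set ε := min (x / 2) (y - x)
  have hε : 0 < ε := lt_min (by linarith [hx.1]) (by linarith)
  have hεx : ε ≤ x / 2 := min_le_left _ _
  have hεy : ε ≤ y - x := min_le_right _ _
  have hpl : ∀ t ∈ Set.Icc 0 ε, x + t ∈ interval R := fun t ht =>
    interval_of_le hy (by linarith [hx.1, ht.1]) (by linarith [ht.2])
  have hmi : ∀ t ∈ Set.Icc 0 ε, x - t ∈ interval R := fun t ht =>
    interval_of_le hx (by linarith [hx.1, ht.2]) (by linarith [ht.1])
  refine ⟨ε, hε, by linarith [hx.1], hpl ε ⟨hε.le, le_rfl⟩, ?_⟩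
  have hord : ∀ {h : ℝ → ℝ}, OrderedAcross R h (2 * x) → ∀ t ∈ Set.Icc 0 ε,
      h (x - t) ≤ h (x + t) := by
    intro h hh t ht
    rcases ht.1.eq_or_lt with h' | h'
    · simp [← h']
    · exact hh _ _ (hmi t ht).1.le (by linarith) (hpl t ht) (by linarith)
  have key := eq_zero_of_second_order_ineq (ε := ε) (D := fun t => f (x + t) - f (x - t))
    (D1 := fun t => deriv f (x + t) + deriv f (x - t))
    (D2 := fun t => deriv (deriv f) (x + t) - deriv (deriv f) (x - t))
    (C := 2 / x) (K := K + κ / x ^ 2) (by have := hx.1; positivity)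
    (by have := C.coeff_nonneg; positivity) ?_ ?_ ?_ (by simp) (by simp [h0]) ?_
  · exact fun t ht => sub_eq_zero.1 (key t ht)
  · intro t ht
    have := ((C.diff _ (hpl t ht)).hasDerivAt.comp_const_add x t).fun_sub
      ((C.diff _ (hmi t ht)).hasDerivAt.comp_const_sub x t)
    simpa using this
  · intro t ht
    have := ((C.diff_deriv _ (hpl t ht)).hasDerivAt.comp_const_add x t).fun_add
      ((C.diff_deriv _ (hmi t ht)).hasDerivAt.comp_const_sub x t)
    simpa [sub_eq_add_neg] using this
  · exact fun t ht => sub_nonneg.2 (hord hf t ht)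
  · intro t ht hD1
    have ht' : t ∈ Set.Icc 0 ε := ⟨ht.1.le, ht.2.le⟩
    have hr := hpl t ht'
    have hs := hmi t ht'
    have hfo := hord hf t ht'
    have hgo := hord hg t ht'
    have hfr := C.deriv_nonneg hf hr (by linarith [ht.1])
    have er := C.eq _ hr
    have es := C.eq _ hs
    have hsx : x / 2 ≤ x - t := by linarith [ht.2]
    have hrx : x ≤ x + t := by linarith [ht.1]
    have hF : F (f (x + t)) (g (x + t)) - F (f (x - t)) (g (x - t))
        ≤ K * (f (x + t) - f (x - t)) := by
      have a1 := C.anti _ hr _ hr _ hs hgo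
      have a2 := hK _ hr _ hs _ hs hfo
      linarith
    have hdr : 0 ≤ deriv f (x + t) / (x + t) + deriv f (x + t) / (x - t) :=
      add_nonneg (div_nonneg hfr hr.1.le) (div_nonneg hfr hs.1.le)
    have hds : (deriv f (x + t) + deriv f (x - t)) / (x - t)
        ≤ 2 / x * (deriv f (x + t) + deriv f (x - t)) := by
      rw [div_le_iff₀ hs.1, mul_right_comm]
      refine le_mul_of_one_le_left hD1 ?_
      rw [div_mul_eq_mul_div, le_div_iff₀ hx.1]
      linarith
    have hκ1 : κ * f (x - t) / (x + t) ^ 2 ≤ κ * f (x - t) / (x - t) ^ 2 :=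
      div_le_div_of_nonneg_left (C.mul_nonneg _ hs) (pow_pos hs.1 2)
        (pow_le_pow_left₀ hs.1.le (by linarith [ht.1]) 2)
    have hκ2 : κ * (f (x + t) - f (x - t)) / (x + t) ^ 2
        ≤ κ * (f (x + t) - f (x - t)) / x ^ 2 :=
      div_le_div_of_nonneg_left (_root_.mul_nonneg C.coeff_nonneg (sub_nonneg.2 hfo))
        (pow_pos hx.1 2) (pow_le_pow_left₀ hx.1.le hrx 2)
    have e1 : κ * (f (x + t) - f (x - t)) / (x + t) ^ 2
        = κ * f (x + t) / (x + t) ^ 2 - κ * f (x - t) / (x + t) ^ 2 := by ring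
    have e2 : κ * (f (x + t) - f (x - t)) / x ^ 2
        = κ / x ^ 2 * (f (x + t) - f (x - t)) := by ring
    have e3 : (deriv f (x + t) + deriv f (x - t)) / (x - t)
        = deriv f (x + t) / (x - t) + deriv f (x - t) / (x - t) := by ring
    rw [e1, e2] at hκ2
    rw [e3] at hds
    rw [add_mul]
    linarith

lemma deriv_pos_of_orderedAcross (C : CoopComponent R κ F f g L φ ψ) (hR : 0 < R) {m r : ℝ}
    (hf : OrderedAcross R f m) (hg : OrderedAcross R g m) (hr : r ∈ interval R)
    (hm : m < 2 * r) : 0 < deriv f r := by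
  refine lt_of_le_of_ne (C.deriv_nonneg hf hr hm.le) fun h0 => ?_
  obtain ⟨S, hS, hSf⟩ := exists_of_eventually_endFilter hR
    (C.lim.eventually (lt_mem_nhds (C.lt r hr)))
  obtain ⟨r1, hr1, hlt⟩ := exists_lt_mem_interval (max_mem_interval hr hS)
  have hrr1 : r < r1 := (le_max_left _ _).trans_lt hlt
  have hfr1 : f r < f r1 := hSf r1 hr1 ((le_max_right _ _).trans_lt hlt)
  -- Move to the right end `x` of the interval on which `f` stays equal to `f r`.
  have hc : ContinuousOn f (Set.Icc r r1) :=
    (C.continuousOn hr1).mono (Set.Icc_subset_Icc_left hr.1.le)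
  have hcomp : IsCompact (Set.Icc r r1 ∩ f ⁻¹' Set.Iic (f r)) :=
    isCompact_Icc.of_isClosed_subset (hc.preimage_isClosed_of_isClosed isClosed_Icc isClosed_Iic)
      Set.inter_subset_left
  obtain ⟨x, ⟨⟨hrx, hxr1⟩, hfx⟩, hmax⟩ := hcomp.exists_isGreatest ⟨r, ⟨le_rfl, hrr1.le⟩,
    le_refl (f r)⟩
  have hfx' : f x ≤ f r := hfx
  have hxI := interval_of_le hr1 (hr.1.trans_le hrx) hxr1
  have hxlt : x < r1 := lt_of_le_of_ne hxr1 (by rintro rfl; linarith)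
  have hdx : deriv f x = 0 := by
    rcases hrx.eq_or_lt with h | h
    · rw [← h, ← h0]
    · refine le_antisymm ?_ (C.deriv_nonneg hf hxI (by linarith))
      have hev : ∀ᶠ y in 𝓝[<] x, f x ≤ f y := by
        filter_upwards [Ioo_mem_nhdsLT h] with y hy
        exact hfx'.trans (hf r y hr.1.le hy.1 (interval_of_le hxI (hr.1.trans hy.1) hy.2.le)
          (by linarith [hy.1]))
      have hd : Tendsto (slope f x) (𝓝[<] x) (𝓝 (deriv f x)) :=
        (hasDerivAt_iff_tendsto_slope.1 (C.diff x hxI).hasDerivAt).mono_left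
          (nhdsWithin_mono _ fun y hy => ne_of_lt hy)
      refine le_of_tendsto hd ?_
      filter_upwards [hev, self_mem_nhdsWithin] with y hy hxy
      have hxy' : y < x := hxy
      rw [slope_def_field]
      exact div_nonpos_of_nonneg_of_nonpos (sub_nonneg.2 hy) (by linarith)
  obtain ⟨ε, hε, hεx, hεI, hsym⟩ := C.eq_reflection_of_deriv_eq_zero hxI
    (hf.mono (by linarith)) (hg.mono (by linarith)) hdx
  set t := min (min ε (r1 - x)) (2 * x - m)
  have ht0 : 0 < t := lt_min (lt_min hε (by linarith)) (by linarith)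
  have htε : t ≤ ε := (min_le_left _ _).trans (min_le_left _ _)
  have htr : t ≤ r1 - x := (min_le_left _ _).trans (min_le_right _ _)
  have htm : t ≤ 2 * x - m := min_le_right _ _
  have h1 : f (x - t) ≤ f x := hf _ _ (by linarith) (by linarith) hxI (by linarith)
  have h2 := hsym t ⟨ht0.le, htε⟩
  have h3 : f (x + t) ≤ f r := by linarith
  have := hmax ⟨⟨by linarith, by linarith⟩, h3⟩
  linarith

/-- At a positive critical value `m`, distinct reflected points have distinct values: at a touching
point the first-order terms in the two-point comparison are strictly negative. -/
lemma lt_of_orderedAcross (C : CoopComponent R κ F f g L φ ψ) (hR : 0 < R) {s r : ℝ}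
    (hf : OrderedAcross R f (s + r)) (hg : OrderedAcross R g (s + r)) (hs : 0 ≤ s)
    (hsr : s < r) (hr : r ∈ interval R) : f s < f r := by
  refine lt_of_le_of_ne (hf s r hs hsr hr le_rfl) fun heq => ?_
  have hpos := C.deriv_pos_of_orderedAcross hR hf hg hr (by linarith)
  rcases hs.eq_or_lt with h0 | h0
  · subst h0
    rcases C.centre with hc | hc
    · exact absurd heq (hc r hr).ne
    · -- `f (r - t) - f t` is nonnegative for small `t > 0` but has slope `-f' r < 0` at `0`.
      have hd1 : HasDerivAt (fun t => f (r - t)) (-deriv f r) 0 := by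
        have : HasDerivAt f (deriv f r) (r - 0) := by
          rw [sub_zero]; exact (C.diff r hr).hasDerivAt
        exact this.comp_const_sub r 0
      have hd := hd1.hasDerivWithinAt (s := Set.Ici 0) |>.fun_sub hc
      have := nonneg_of_hasDerivWithinAt_Ici hd (by
        filter_upwards [Ioo_mem_nhdsGT (show 0 < r / 2 by linarith)] with t ht
        have := hf t (r - t) ht.1.le (by linarith [ht.2])
          (interval_of_le hr (by linarith [ht.1, ht.2]) (by linarith [ht.1])) (by linarith)
        simp only [sub_zero]
        linarith)
      linarith
  · have hsI := interval_of_le hr h0 hsr.le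
    have hmin : IsLocalMin (fun t => f (r + t) - f (s - t)) 0 := by
      filter_upwards [eventually_reflected h0 hsr hr] with t ht
      have := hf _ _ ht.1.le ht.2.1 ht.2.2.2 (by linarith)
      simp only [add_zero, sub_zero]
      linarith
    have h1 := C.deriv_mul_le_of_isLocalMin h0 hsr hr heq.ge hmin
    have h2 := C.anti r hr r hr s hsI (hg s r hs hsr hr le_rfl)
    have h3 : 0 < deriv f r * (1 / r + 1 / s) :=
      mul_pos hpos (add_pos (one_div_pos.2 hr.1) (one_div_pos.2 h0))
    rw [← heq] at h1 h2
    linarith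

lemma deriv_pos_at_reflection_point (C : CoopComponent R κ F f g L φ ψ) (hR : 0 < R) {x : ℝ}
    (hx : x ∈ interval R) (hf : OrderedAcross R f (2 * x)) (hg : OrderedAcross R g (2 * x)) :
    0 < deriv f x := by
  refine lt_of_le_of_ne (C.deriv_nonneg hf hx le_rfl) fun h0 => ?_
  obtain ⟨ε, hε, hεx, hεI, h⟩ := C.eq_reflection_of_deriv_eq_zero hx hf hg h0.symm
  have e : 2 * x = x - ε + (x + ε) := by ring
  rw [e] at hf hg
  have := C.lt_of_orderedAcross hR hf hg (by linarith) (by linarith) hεI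
  linarith [h ε ⟨hε.le, le_rfl⟩]

/-- The reflection parameter can be decreased as long as it is positive. -/
lemma exists_orderedAcross_lt (C : CoopComponent R κ F f g L φ ψ) (hR : 0 < R) {x : ℝ}
    (hx : x ∈ interval R) (hf : OrderedAcross R f (2 * x)) (hg : OrderedAcross R g (2 * x)) :
    ∃ m < 2 * x, 0 ≤ m ∧ OrderedAcross R f m := by
  by_contra! hno
  obtain ⟨S, hS, hSf⟩ := C.exists_forall_lt hR hx
  have hx0 := hx.1
  have hseq : ∀ n : ℕ, ∃ p : ℝ × ℝ, 0 ≤ p.1 ∧ p.1 < p.2 ∧ p.2 ∈ interval R ∧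
      2 * x - x / (n + 1) ≤ p.1 + p.2 ∧ f p.2 < f p.1 := by
    intro n
    have hn : 0 < x / ((n : ℝ) + 1) := by positivity
    have hn' : x / ((n : ℝ) + 1) ≤ x := div_le_self hx0.le (by simp)
    have := hno (2 * x - x / (n + 1)) (by linarith) (by linarith)
    unfold OrderedAcross at this
    push Not at this
    obtain ⟨s, r, h1, h2, h3, h4, h5⟩ := this
    exact ⟨(s, r), h1, h2, h3, h4, h5⟩
  choose p h0 hlt hI hsum hval using hseq
  have hsum' : ∀ n, (p n).1 + (p n).2 < 2 * x := fun n => by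
    by_contra! h
    exact absurd (hf _ _ (h0 n) (hlt n) (hI n) h) (not_le.2 (hval n))
  have hp1 : ∀ n, (p n).1 ≤ x := fun n => by linarith [hlt n, hsum' n]
  have hp2 : ∀ n, (p n).2 ≤ S := fun n => by
    by_contra! h
    exact absurd (hSf _ (hI n) h _ ⟨h0 n, hp1 n⟩) (not_lt.2 (hval n).le)
  have hmem : ∀ n, p n ∈ Set.Icc 0 x ×ˢ Set.Icc 0 S := fun n =>
    ⟨⟨h0 n, hp1 n⟩, (hI n).1.le, hp2 n⟩
  obtain ⟨⟨s, r⟩, hsr, θ, hθ, hlim⟩ :=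
    (isCompact_Icc.prod isCompact_Icc).tendsto_subseq hmem
  have hl1 : Tendsto (fun n => (p (θ n)).1) atTop (𝓝 s) :=
    (continuous_fst.tendsto _).comp hlim
  have hl2 : Tendsto (fun n => (p (θ n)).2) atTop (𝓝 r) :=
    (continuous_snd.tendsto _).comp hlim
  have hle : s ≤ r := le_of_tendsto_of_tendsto' hl1 hl2 fun n => (hlt _).le
  have hsum2 : s + r = 2 * x := by
    refine tendsto_nhds_unique (hl1.add hl2) ?_
    have hinv : Tendsto (fun n : ℕ => 2 * x - x / ((n : ℝ) + 1)) atTop (𝓝 (2 * x)) := by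
      have := (tendsto_one_div_add_atTop_nhds_zero_nat (𝕜 := ℝ)).const_mul x
      simpa [div_eq_mul_inv] using this.const_sub (2 * x)
    exact tendsto_of_tendsto_of_tendsto_of_le_of_le (hinv.comp hθ.tendsto_atTop)
      tendsto_const_nhds (fun n => hsum _) (fun n => (hsum' _).le)
  have hs0 : 0 ≤ s := hsr.1.1
  have hrI : r ∈ interval R := interval_of_le hS (by linarith) hsr.2.2
  rcases hle.eq_or_lt with h | h
  · have hsx : s = x := by linarith
    have hrx : r = x := by linarith
    rw [hsx] at hl1
    rw [hrx] at hl2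
    have hd := C.deriv_pos_at_reflection_point hR hx hf hg
    obtain ⟨ε, hε, hball⟩ := Metric.eventually_nhds_iff_ball.1
      (((C.diff_deriv x hx).continuousAt.eventually (lt_mem_nhds hd)).and
        ((isOpen_interval R).mem_nhds hx))
    have hmono : StrictMonoOn f (Metric.ball x ε) := by
      refine strictMonoOn_of_deriv_pos (convex_ball _ _)
        (fun y hy => (C.continuousAt (hball y hy).2).continuousWithinAt) fun y hy => ?_
      exact (hball y (interior_subset hy)).1
    obtain ⟨n, hn1, hn2⟩ := ((hl1.eventually (Metric.ball_mem_nhds x hε)).and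
      (hl2.eventually (Metric.ball_mem_nhds x hε))).exists
    exact absurd (hmono hn1 hn2 (hlt _)) (not_lt.2 (hval _).le)
  · rw [← hsum2] at hf hg
    have hstrict := C.lt_of_orderedAcross hR hf hg hs0 h hrI
    have hM := max_mem_interval hx hS
    have hc := C.continuousOn hM
    have hc1 : Tendsto (fun n => f (p (θ n)).1) atTop (𝓝 (f s)) := by
      refine (hc s ⟨hs0, hsr.1.2.trans (le_max_left _ _)⟩).tendsto.comp
        (tendsto_nhdsWithin_iff.2 ⟨hl1, Eventually.of_forall fun n => ?_⟩)
      exact ⟨h0 _, (hp1 _).trans (le_max_left _ _)⟩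
    have hc2 : Tendsto (fun n => f (p (θ n)).2) atTop (𝓝 (f r)) :=
      (C.continuousAt hrI).tendsto.comp hl2
    exact absurd (le_of_tendsto_of_tendsto' hc2 hc1 fun n => (hval _).le) (not_le.2 hstrict)

/-- The two-point function `f r - f s` has no negative minimum at which the nonlinearity
decreases. -/
lemma not_neg_two_point_min (C : CoopComponent R κ F f g L φ ψ) {m s r : ℝ} (hs : 0 < s)
    (hsr : s < r) (hr : r ∈ interval R) (hm : m ≤ s + r) (hneg : f r ≤ f s)
    (hF : F (f r) (g r) < F (f s) (g s))
    (hmin : ∀ s' r', 0 ≤ s' → s' ≤ r' → r' ∈ interval R → m ≤ s' + r' →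
      f r - f s ≤ f r' - f s') : False := by
  have hloc : IsLocalMin (fun t => f (r + t) - f (s - t)) 0 := by
    filter_upwards [eventually_reflected hs hsr hr] with t ht
    simp only [add_zero, sub_zero]
    exact hmin _ _ ht.1.le ht.2.1.le ht.2.2.2 (by linarith)
  have h1 := C.deriv_mul_le_of_isLocalMin hs hsr hr hneg hloc
  have h2 : 0 ≤ deriv f r := by
    refine nonneg_of_hasDerivWithinAt_Ici (C.diff r hr).hasDerivAt.hasDerivWithinAt ?_
    filter_upwards [self_mem_nhdsWithin,
      mem_nhdsWithin_of_mem_nhds ((isOpen_interval R).mem_nhds hr)] with y hy hyI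
    have hy' : r < y := hy
    have := hmin s y hs.le (hsr.trans hy').le hyI (by linarith)
    linarith
  have h3 : 0 ≤ deriv f r * (1 / r + 1 / s) :=
    _root_.mul_nonneg h2 (add_nonneg (one_div_nonneg.2 hr.1.le) (one_div_nonneg.2 hs.le))
  linarith

end CoopComponent

variable {R : EReal} {κ κ' L L' φ ψ : ℝ} {F F' : ℝ → ℝ → ℝ} {f g : ℝ → ℝ}

/-- Start of the continuation: both components are ordered for reflections close to `R`, by the
maximum principle for the two-point function and positivity of the linearization at `R`. -/
lemma exists_orderedAcross (hR : 0 < R) (C : CoopComponent R κ F f g L φ ψ)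
    (C' : CoopComponent R κ' F' g f L' ψ φ) :
    ∃ x ∈ interval R, OrderedAcross R f (2 * x) ∧ OrderedAcross R g (2 * x) := by
  obtain ⟨Sa, hSa, hFa⟩ := C.end_neg
  obtain ⟨Sb, hSb, hFb⟩ := C'.end_neg
  have hφ := C.pos_weight
  have hψ := C'.pos_weight
  set S1 := max Sa Sb
  have hS1 : S1 ∈ interval R := max_mem_interval hSa hSb
  obtain ⟨Sc, hSc, hfc⟩ := C.exists_forall_lt hR hS1
  obtain ⟨Sd, hSd, hgd⟩ := C'.exists_forall_lt hR hS1
  set S := max S1 (max Sc Sd)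
  have hS : S ∈ interval R := max_mem_interval hS1 (max_mem_interval hSc hSd)
  have hSS1 : S1 ≤ S := le_max_left _ _
  have hSSc : Sc ≤ S := (le_max_left _ _).trans (le_max_right _ _)
  have hSSd : Sd ≤ S := (le_max_right _ _).trans (le_max_right _ _)
  set M : ℝ → ℝ → ℝ := fun s r => min ((f r - f s) / φ) ((g r - g s) / ψ) with hM
  suffices hmain : ∀ s r, 0 ≤ s → s < r → r ∈ interval R → 2 * S ≤ s + r → 0 ≤ M s r by
    refine ⟨S, hS, fun s r h0 h1 h2 h3 => ?_, fun s r h0 h1 h2 h3 => ?_⟩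
    · have := (hmain s r h0 h1 h2 h3).trans (min_le_left _ _)
      linarith [(le_div_iff₀ hφ).1 this]
    · have := (hmain s r h0 h1 h2 h3).trans (min_le_right _ _)
      linarith [(le_div_iff₀ hψ).1 this]
  intro s0 r0 h0 hlt0 hr0 hsum0
  by_contra! hneg
  -- Beyond `T` the two-point function is larger than its value at `(s0, r0)`.
  obtain ⟨Se, hSe, hfe⟩ := exists_of_eventually_endFilter hR
    (C.lim.eventually (lt_mem_nhds (show L + φ * M s0 r0 < L by nlinarith)))
  obtain ⟨Sf, hSf, hgf⟩ := exists_of_eventually_endFilter hR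
    (C'.lim.eventually (lt_mem_nhds (show L' + ψ * M s0 r0 < L' by nlinarith)))
  set T := max r0 (max Se Sf)
  have hT : T ∈ interval R := max_mem_interval hr0 (max_mem_interval hSe hSf)
  have hTr : r0 ≤ T := le_max_left _ _
  have hTe : Se ≤ T := (le_max_left _ _).trans (le_max_right _ _)
  have hTf : Sf ≤ T := (le_max_right _ _).trans (le_max_right _ _)
  set A : Set (ℝ × ℝ) := (Set.Icc 0 T ×ˢ Set.Icc 0 T) ∩ {q | q.1 ≤ q.2 ∧ 2 * S ≤ q.1 + q.2} with hA
  have hAc : IsCompact A := by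
    refine (isCompact_Icc.prod isCompact_Icc).inter_right ?_
    exact (isClosed_le continuous_fst continuous_snd).inter
      (isClosed_le continuous_const (continuous_fst.add continuous_snd))
  have hcont : ContinuousOn (fun q : ℝ × ℝ => M q.1 q.2) A := by
    have k1 : ∀ {h : ℝ → ℝ}, ContinuousOn h (Set.Icc 0 T) →
        ContinuousOn (fun q : ℝ × ℝ => h q.2 - h q.1) A := fun hh =>
      (hh.comp continuousOn_snd fun q hq => hq.1.2).sub
        (hh.comp continuousOn_fst fun q hq => hq.1.1)
    exact ((k1 (C.continuousOn hT)).div_const φ).inf ((k1 (C'.continuousOn hT)).div_const ψ)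
  obtain ⟨⟨s, r⟩, ⟨⟨hsT, hrT⟩, hsr', hsum'⟩, hminA⟩ := hAc.exists_isMinOn
    ⟨(s0, r0), ⟨⟨h0, hlt0.le.trans hTr⟩, hr0.1.le, hTr⟩, hlt0.le, hsum0⟩ hcont
  have hsr : s ≤ r := hsr'
  have hsum : 2 * S ≤ s + r := hsum'
  have hs0 : 0 ≤ s := hsT.1
  have hM0 : M s r ≤ M s0 r0 :=
    hminA (a := (s0, r0)) ⟨⟨⟨h0, hlt0.le.trans hTr⟩, hr0.1.le, hTr⟩, hlt0.le, hsum0⟩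
  have hMneg : M s r < 0 := hM0.trans_lt hneg
  have hglob : ∀ s' r', 0 ≤ s' → s' ≤ r' → r' ∈ interval R → 2 * S ≤ s' + r' →
      M s r ≤ M s' r' := by
    intro s' r' h1 h2 h3 h4
    rcases le_or_gt r' T with h | h
    · exact hminA (a := (s', r')) ⟨⟨⟨h1, h2.trans h⟩, h3.1.le, h⟩, h2, h4⟩
    · refine hM0.trans (le_min ?_ ?_)
      · rw [le_div_iff₀ hφ]
        linarith [hfe r' h3 (hTe.trans_lt h), C.lt_of_nonneg h1 h2 h3]
      · rw [le_div_iff₀ hψ]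
        linarith [hgf r' h3 (hTf.trans_lt h), C'.lt_of_nonneg h1 h2 h3]
  have hsr2 : s < r := by
    refine lt_of_le_of_ne hsr ?_
    rintro rfl
    simp [hM] at hMneg
  have hSr : S < r := by linarith
  have hrI : r ∈ interval R := interval_of_le hT (hS.1.trans hSr) hrT.2
  have hS1s : S1 < s := by
    by_contra! h
    have h1 := hfc r hrI (hSSc.trans_lt hSr) s ⟨hs0, h⟩
    have h2 := hgd r hrI (hSSd.trans_lt hSr) s ⟨hs0, h⟩
    exact absurd hMneg (not_lt.2 (le_min (div_nonneg (by linarith) hφ.le)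
      (div_nonneg (by linarith) hψ.le)))
  have hspos : 0 < s := hS1.1.trans hS1s
  have hsI := interval_of_le hrI hspos hsr
  have hleft : M s r * φ ≤ f r - f s := (le_div_iff₀ hφ).1 (min_le_left _ _)
  have hright : M s r * ψ ≤ g r - g s := (le_div_iff₀ hψ).1 (min_le_right _ _)
  have hδ : 0 < -M s r := by linarith
  rcases min_choice ((f r - f s) / φ) ((g r - g s) / ψ) with h | h
  · have he : f r - f s = M s r * φ := by
      rw [hM]; simp only; rw [h, div_mul_cancel₀ _ hφ.ne']
    refine C.not_neg_two_point_min hspos hsr2 hrI hsum (by nlinarith) ?_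
      fun s' r' h1 h2 h3 h4 => ?_
    · exact hFa r hrI s hsI ((le_max_left _ _).trans_lt (hS1s.trans hsr2))
        ((le_max_left _ _).trans_lt hS1s) _ hδ (by linarith) (by linarith)
    · rw [he, ← le_div_iff₀ hφ]
      exact (hglob s' r' h1 h2 h3 h4).trans (min_le_left _ _)
  · have he : g r - g s = M s r * ψ := by
      rw [hM]; simp only; rw [h, div_mul_cancel₀ _ hψ.ne']
    refine C'.not_neg_two_point_min hspos hsr2 hrI hsum (by nlinarith) ?_
      fun s' r' h1 h2 h3 h4 => ?_
    · exact hFb r hrI s hsI ((le_max_right _ _).trans_lt (hS1s.trans hsr2))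
        ((le_max_right _ _).trans_lt hS1s) _ hδ (by linarith) (by linarith)
    · rw [he, ← le_div_iff₀ hψ]
      exact (hglob s' r' h1 h2 h3 h4).trans (min_le_right _ _)

lemma orderedAcross_of_forall_gt (C : CoopComponent R κ F f g L φ ψ) {m : ℝ}
    (h : ∀ m' > m, OrderedAcross R f m') : OrderedAcross R f m := by
  intro s r h0 hsr hr hm
  have hc : Tendsto f (𝓝[>] r) (𝓝 (f r)) := (C.continuousAt hr).mono_left nhdsWithin_le_nhds
  refine ge_of_tendsto hc ?_
  filter_upwards [self_mem_nhdsWithin,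
    mem_nhdsWithin_of_mem_nhds ((isOpen_interval R).mem_nhds hr)] with y hy hyI
  have hy' : r < y := hy
  exact h (s + y) (by linarith) s y h0 (hsr.trans hy') hyI le_rfl

/-- Both components of a cooperative radial system are strictly increasing. -/
theorem deriv_pos_of_coopComponent (hR : 0 < R) (C : CoopComponent R κ F f g L φ ψ)
    (C' : CoopComponent R κ' F' g f L' ψ φ) :
    ∀ r ∈ interval R, 0 < deriv f r ∧ 0 < deriv g r := by
  set Λ : Set ℝ := {m | 0 ≤ m ∧ OrderedAcross R f m ∧ OrderedAcross R g m} with hΛ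
  obtain ⟨x, hx, hxf, hxg⟩ := exists_orderedAcross hR C C'
  have hxΛ : 2 * x ∈ Λ := ⟨by linarith [hx.1], hxf, hxg⟩
  have hbdd : BddBelow Λ := ⟨0, fun m hm => hm.1⟩
  set m := sInf Λ
  have hm0 : 0 ≤ m := le_csInf ⟨_, hxΛ⟩ fun m hm => hm.1
  have hgt : ∀ m' > m, OrderedAcross R f m' ∧ OrderedAcross R g m' := fun m' hm' => by
    obtain ⟨a, ha, ham⟩ := exists_lt_of_csInf_lt ⟨_, hxΛ⟩ hm'
    exact ⟨ha.2.1.mono ham.le, ha.2.2.mono ham.le⟩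
  have hf : OrderedAcross R f m := orderedAcross_of_forall_gt C fun m' h => (hgt m' h).1
  have hg : OrderedAcross R g m := orderedAcross_of_forall_gt C' fun m' h => (hgt m' h).2
  have hmz : m = 0 := by
    by_contra hne
    have hmpos : 0 < m := lt_of_le_of_ne hm0 (Ne.symm hne)
    have hmx : m ≤ 2 * x := csInf_le hbdd hxΛ
    have hmI : m / 2 ∈ interval R := interval_of_le hx (by linarith) (by linarith)
    have e : m = 2 * (m / 2) := by ring
    rw [e] at hf hg
    obtain ⟨m1, hm1, hm10, h1⟩ := C.exists_orderedAcross_lt hR hmI hf hg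
    obtain ⟨m2, hm2, hm20, h2⟩ := C'.exists_orderedAcross_lt hR hmI hg hf
    have : m ≤ max m1 m2 := csInf_le hbdd ⟨hm10.trans (le_max_left _ _),
      h1.mono (le_max_left _ _), h2.mono (le_max_right _ _)⟩
    have := max_lt hm1 hm2
    linarith
  rw [hmz] at hf hg
  intro r hr
  exact ⟨C.deriv_pos_of_orderedAcross hR hf hg hr (by linarith [hr.1]),
    C'.deriv_pos_of_orderedAcross hR hg hf hr (by linarith [hr.1])⟩

/-! ### Reduced form of the nonlinearities -/

/-- `hFun` written with `γ = c²`, `σ = s₊/√6`, `β = b²/(√6 c²)`; it vanishes at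
`(√3 σ, -σ)`. -/
def hRed (γ σ β p q : ℝ) : ℝ :=
  γ * (p * (p ^ 2 - 3 * σ ^ 2 + (q + σ) * (q - σ + 2 * β)))

/-- `gFun` written with `γ = c²`, `σ = s₊/√6`, `β = b²/(√6 c²)`; the argument `q` comes first,
as the component of the unknown to which the equation belongs. -/
def gRed (γ σ β q p : ℝ) : ℝ :=
  γ * ((q + β) * (p ^ 2 - 3 * σ ^ 2) + (q + σ) * (q ^ 2 - (β + σ) * q + 3 * β * σ))

/-- A solution of the boundary value problem in the reduced parameters, with `τ = √3 σ` the
boundary value of `u`. The bound `β ≤ 2σ` expresses `a² ≥ 0`. -/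
structure ReducedProfile (R : EReal) (κ γ σ β τ : ℝ) (u v : ℝ → ℝ) : Prop where
  R_pos : 0 < R
  κ_pos : 0 < κ
  γ_pos : 0 < γ
  σ_pos : 0 < σ
  β_pos : 0 < β
  β_le : β ≤ 2 * σ
  τ_pos : 0 < τ
  τ_sq : τ ^ 2 = 3 * σ ^ 2
  diff_u : ∀ r ∈ interval R, DifferentiableAt ℝ u r
  diff_v : ∀ r ∈ interval R, DifferentiableAt ℝ v r
  diff_deriv_u : ∀ r ∈ interval R, DifferentiableAt ℝ (deriv u) r
  diff_deriv_v : ∀ r ∈ interval R, DifferentiableAt ℝ (deriv v) r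
  eq_u : ∀ r ∈ interval R,
    deriv (deriv u) r + deriv u r / r - κ * u r / r ^ 2 = hRed γ σ β (u r) (v r)
  eq_v : ∀ r ∈ interval R, deriv (deriv v) r + deriv v r / r = gRed γ σ β (v r) (u r)
  u_zero : u 0 = 0
  cont_u : ContinuousWithinAt u (Set.Ici 0) 0
  deriv_v_zero : HasDerivWithinAt v 0 (Set.Ici 0) 0
  u_lim : Tendsto u (endFilter R) (𝓝 τ)
  v_lim : Tendsto v (endFilter R) (𝓝 (-σ))
  u_pos : ∀ r ∈ interval R, 0 < u r
  v_neg : ∀ r ∈ interval R, v r < 0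

lemma mul_hRed_add_mul_gRed_pos {γ σ β p q : ℝ} (hγ : 0 < γ) (hσ : 0 < σ) (hβ0 : 0 < β)
    (hβ : β ≤ 2 * σ) (h : 4 * σ ^ 2 < p ^ 2 + q ^ 2) :
    0 < p * hRed γ σ β p q + q * gRed γ σ β q p := by
  set ρ := Real.sqrt (p ^ 2 + q ^ 2) with hρ
  have hρ0 : 0 ≤ ρ := Real.sqrt_nonneg _
  have hρ2 : ρ ^ 2 = p ^ 2 + q ^ 2 := Real.sq_sqrt (by positivity)
  have hρσ : 2 * σ < ρ := by
    by_contra! hle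
    have : ρ ^ 2 ≤ (2 * σ) ^ 2 := pow_le_pow_left₀ hρ0 hle 2
    nlinarith
  -- In polar coordinates `q (3 p² - q²)` is `ρ³` times the sine of a triple angle.
  have htriple : |q * (3 * p ^ 2 - q ^ 2)| ≤ ρ ^ 3 := by
    refine abs_le_of_sq_le_sq ?_ (by positivity)
    have e : (ρ ^ 3) ^ 2 = (p ^ 2 + q ^ 2) ^ 3 := by rw [← hρ2]; ring
    rw [e]
    have := sq_nonneg (p * (p ^ 2 - 3 * q ^ 2))
    linarith
  have h1 := neg_le_of_abs_le htriple
  have e : p * hRed γ σ β p q + q * gRed γ σ β q p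
      = γ * (ρ ^ 2 * (ρ ^ 2 - (4 * σ ^ 2 - 2 * β * σ)) + β * (q * (3 * p ^ 2 - q ^ 2))) := by
    rw [hρ2]; unfold hRed gRed; ring
  rw [e]
  refine mul_pos hγ ?_
  have h2 : 0 < ρ ^ 2 * ((ρ - 2 * σ) * (ρ + 2 * σ - β)) :=
    mul_pos (pow_pos (by linarith) 2) (mul_pos (by linarith) (by linarith))
  have h3 := mul_le_mul_of_nonneg_left h1 hβ0.le
  nlinarith

/-- The sign `ε = ±1` distinguishes the regimes `β ≤ σ` and `σ ≤ β`. Where `ε v` exceeds its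
boundary value `-ε σ`, the function `ε v` is strictly subharmonic. -/
lemma sign_mul_gRed_pos {γ σ β ε p q : ℝ} (hγ : 0 < γ) (hσ : 0 < σ) (hβ0 : 0 < β)
    (hε : ε = 1 ∨ ε = -1) (hd : 0 ≤ ε * (σ - β)) (hq : q < 0)
    (hpq : p ^ 2 + q ^ 2 ≤ 4 * σ ^ 2) (h : 0 < ε * (q + σ)) : 0 < ε * gRed γ σ β q p := by
  obtain ⟨y, rfl⟩ : ∃ y, q = -y := ⟨-q, by ring⟩
  have hy : 0 < y := by linarith
  unfold gRed
  rw [mul_left_comm]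
  refine mul_pos hγ ?_
  -- Away from the strip between `β` and `σ` the value is bounded by its value at `p = 0`.
  have e0 : (-y + β) * (p ^ 2 - 3 * σ ^ 2) + (-y + σ) * ((-y) ^ 2 - (β + σ) * -y + 3 * β * σ)
      = (β - y) * p ^ 2 - y * (y ^ 2 + β * y - 4 * σ ^ 2 + 2 * β * σ) := by ring
  have e1 : (-y + β) * (p ^ 2 - 3 * σ ^ 2) + (-y + σ) * ((-y) ^ 2 - (β + σ) * -y + 3 * β * σ)
      = (y - β) * (4 * σ ^ 2 - (p ^ 2 + (-y) ^ 2)) + (σ - y) * (2 * β * y + 4 * β * σ) := by ring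
  rcases hε with rfl | rfl
  · have hyσ : y < σ := by linarith
    rcases le_or_gt β y with hyβ | hyβ
    · rw [e1]
      have h1 := mul_nonneg (sub_nonneg.2 hyβ) (sub_nonneg.2 hpq)
      have h2 : 0 < (σ - y) * (2 * β * y + 4 * β * σ) := mul_pos (by linarith) (by positivity)
      linarith
    · rw [e0]
      have h1 : 0 ≤ (β - y) * p ^ 2 := mul_nonneg (by linarith) (sq_nonneg _)
      have h2 : y ^ 2 + β * y - 4 * σ ^ 2 + 2 * β * σ < 0 := by nlinarith
      nlinarith
  · have hyσ : σ < y := by linarith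
    rcases le_or_gt β y with hyβ | hyβ
    · rw [e0]
      have h1 : 0 ≤ (y - β) * p ^ 2 := mul_nonneg (by linarith) (sq_nonneg _)
      have h2 : 0 < y ^ 2 + β * y - 4 * σ ^ 2 + 2 * β * σ := by nlinarith
      nlinarith
    · rw [e1]
      have h1 := mul_nonneg (sub_nonneg.2 hyβ.le) (sub_nonneg.2 hpq)
      have h2 : 0 < (y - σ) * (2 * β * y + 4 * β * σ) := mul_pos (by linarith) (by positivity)
      linarith

/-! ### A priori bounds -/

namespace ReducedProfile

variable {R : EReal} {κ γ σ β τ : ℝ} {u v : ℝ → ℝ}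

lemma sq_add_sq_le (P : ReducedProfile R κ γ σ β τ u v) :
    ∀ r ∈ interval R, u r ^ 2 + v r ^ 2 ≤ 4 * σ ^ 2 := by
  have hd : ∀ {f : ℝ → ℝ} {f' r : ℝ}, HasDerivAt f f' r →
      HasDerivAt (fun x => f x ^ 2) (2 * (f r * f')) r := fun hf => by
    simpa [mul_assoc] using hf.fun_pow 2
  have key := nonpos_of_radial_subharmonic P.R_pos
    (w := fun r => u r ^ 2 + v r ^ 2 - 4 * σ ^ 2)
    (w1 := fun r => 2 * (u r * deriv u r) + 2 * (v r * deriv v r))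
    (w2 := fun r => 2 * (deriv u r * deriv u r + u r * deriv (deriv u) r)
      + 2 * (deriv v r * deriv v r + v r * deriv (deriv v) r))
    (l := τ ^ 2 + (-σ) ^ 2 - 4 * σ ^ 2) ?_ ?_ ?_ ?_ ?_ ?_
  · exact fun r hr => sub_nonpos.1 (key r hr)
  · exact fun r hr => ((hd (P.diff_u r hr).hasDerivAt).fun_add
      (hd (P.diff_v r hr).hasDerivAt)).sub_const _
  · intro r hr
    exact (((P.diff_u r hr).hasDerivAt.fun_mul
      (P.diff_deriv_u r hr).hasDerivAt).const_mul 2).fun_add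
      (((P.diff_v r hr).hasDerivAt.fun_mul (P.diff_deriv_v r hr).hasDerivAt).const_mul 2)
  · exact ((P.cont_u.pow 2).add (P.deriv_v_zero.continuousWithinAt.pow 2)).sub
      continuousWithinAt_const
  · exact ((P.u_lim.pow 2).add (P.v_lim.pow 2)).sub_const _
  · rw [P.τ_sq]; apply le_of_eq; ring
  · intro r hr hpos
    have h1 := mul_hRed_add_mul_gRed_pos (p := u r) (q := v r) P.γ_pos P.σ_pos P.β_pos P.β_le
      (by linarith)
    rw [← P.eq_u r hr, ← P.eq_v r hr] at h1
    have hr0 := hr.1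
    have hκ : 0 ≤ κ * u r ^ 2 / r ^ 2 := by have := P.κ_pos; positivity
    have e : 2 * (deriv u r * deriv u r + u r * deriv (deriv u) r)
        + 2 * (deriv v r * deriv v r + v r * deriv (deriv v) r)
        + (2 * (u r * deriv u r) + 2 * (v r * deriv v r)) / r
        = 2 * (deriv u r ^ 2 + deriv v r ^ 2) + 2 * (κ * u r ^ 2 / r ^ 2)
          + 2 * (u r * (deriv (deriv u) r + deriv u r / r - κ * u r / r ^ 2)
            + v r * (deriv (deriv v) r + deriv v r / r)) := by ring
    rw [e]
    nlinarith [sq_nonneg (deriv u r), sq_nonneg (deriv v r)]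

lemma sign_mul_add_le (P : ReducedProfile R κ γ σ β τ u v) {ε : ℝ} (hε : ε = 1 ∨ ε = -1)
    (hd : 0 ≤ ε * (σ - β)) : ∀ r ∈ interval R, ε * (v r + σ) ≤ 0 := by
  refine nonpos_of_radial_subharmonic P.R_pos (w1 := fun r => ε * deriv v r)
    (w2 := fun r => ε * deriv (deriv v) r) (l := ε * (-σ + σ)) ?_ ?_ ?_ ?_ (by simp) ?_
  · exact fun r hr => ((P.diff_v r hr).hasDerivAt.add_const σ).const_mul ε
  · exact fun r hr => (P.diff_deriv_v r hr).hasDerivAt.const_mul ε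
  · exact continuousWithinAt_const.mul
      (P.deriv_v_zero.continuousWithinAt.add continuousWithinAt_const)
  · exact (P.v_lim.add_const σ).const_mul ε
  · intro r hr hpos
    have h := sign_mul_gRed_pos (p := u r) (q := v r) P.γ_pos P.σ_pos P.β_pos hε hd
      (P.v_neg r hr) (P.sq_add_sq_le r hr) hpos
    rw [← P.eq_v r hr] at h
    calc _ < _ := h
      _ = _ := by ring

lemma cross_nonneg (P : ReducedProfile R κ γ σ β τ u v) {r : ℝ} (hr : r ∈ interval R) :
    0 ≤ (v r + σ) * (v r - σ + 2 * β) := by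
  rcases le_total β σ with h | h
  · have := P.sign_mul_add_le (Or.inl rfl) (by linarith) r hr
    exact mul_nonneg_of_nonpos_of_nonpos (by linarith) (by linarith)
  · have := P.sign_mul_add_le (Or.inr rfl) (by linarith) r hr
    exact mul_nonneg (by linarith) (by linarith)

lemma deriv2_u_pos (P : ReducedProfile R κ γ σ β τ u v) {r : ℝ} (hr : r ∈ interval R)
    (h : τ ≤ u r) : 0 < deriv (deriv u) r + deriv u r / r := by
  have hr0 := hr.1
  have hu := P.u_pos r hr
  have h1 : 0 < κ * u r / r ^ 2 := by have := P.κ_pos; positivity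
  have h2 : 3 * σ ^ 2 ≤ u r ^ 2 := by
    rw [← P.τ_sq]; exact pow_le_pow_left₀ P.τ_pos.le h 2
  have h3 : 0 ≤ hRed γ σ β (u r) (v r) :=
    mul_nonneg P.γ_pos.le (mul_nonneg hu.le (by linarith [P.cross_nonneg hr]))
  rw [← P.eq_u r hr] at h3
  linarith

lemma u_le (P : ReducedProfile R κ γ σ β τ u v) : ∀ r ∈ interval R, u r ≤ τ := by
  have key := nonpos_of_radial_subharmonic P.R_pos (w := fun r => u r - τ) (w1 := deriv u)
    (w2 := deriv (deriv u)) (l := τ - τ)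
    (fun r hr => (P.diff_u r hr).hasDerivAt.sub_const τ)
    (fun r hr => (P.diff_deriv_u r hr).hasDerivAt)
    (P.cont_u.sub continuousWithinAt_const) (P.u_lim.sub_const τ) (by simp)
    (fun r hr hpos => P.deriv2_u_pos hr (by linarith))
  exact fun r hr => sub_nonpos.1 (key r hr)

lemma u_lt (P : ReducedProfile R κ γ σ β τ u v) : ∀ r ∈ interval R, u r < τ := by
  intro r hr
  refine lt_of_le_of_ne (P.u_le r hr) fun heq => ?_
  have hmax : IsLocalMax u r := by
    filter_upwards [(isOpen_interval R).mem_nhds hr] with y hy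
    rw [heq]; exact P.u_le y hy
  have h1 : 0 ≤ -deriv (deriv u) r := by
    refine nonneg_second_deriv_of_isLocalMin hmax.neg (f' := fun y => -deriv u y) ?_
      (P.diff_deriv_u r hr).hasDerivAt.neg
    filter_upwards [(isOpen_interval R).mem_nhds hr] with y hy
    exact (P.diff_u y hy).hasDerivAt.neg
  have h2 := P.deriv2_u_pos hr heq.ge
  rw [hmax.deriv_eq_zero, zero_div] at h2
  linarith

lemma u_sq_lt (P : ReducedProfile R κ γ σ β τ u v) {r : ℝ} (hr : r ∈ interval R) :
    u r ^ 2 < 3 * σ ^ 2 := by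
  rw [← P.τ_sq]; exact pow_lt_pow_left₀ (P.u_lt r hr) (P.u_pos r hr).le two_ne_zero

lemma sign_mul_add_lt (P : ReducedProfile R κ γ σ β τ u v) {ε : ℝ} (hε : ε = 1 ∨ ε = -1)
    (hd : 0 < ε * (σ - β)) : ∀ r ∈ interval R, ε * (v r + σ) < 0 := by
  have hle := P.sign_mul_add_le hε hd.le
  have hεne : ε ≠ 0 := by rcases hε with rfl | rfl <;> norm_num
  intro r hr
  refine lt_of_le_of_ne (hle r hr) fun heq => ?_
  have hmax : IsLocalMin (fun y => -(ε * (v y + σ))) r := by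
    filter_upwards [(isOpen_interval R).mem_nhds hr] with y hy
    rw [heq]; linarith [hle y hy]
  have hder : ∀ᶠ y in 𝓝 r, HasDerivAt (fun y => -(ε * (v y + σ))) (-(ε * deriv v y)) y := by
    filter_upwards [(isOpen_interval R).mem_nhds hr] with y hy
    exact (((P.diff_v y hy).hasDerivAt.add_const σ).const_mul ε).neg
  have h1 := nonneg_second_deriv_of_isLocalMin hmax hder
    ((P.diff_deriv_v r hr).hasDerivAt.const_mul ε).neg
  have h2 := hmax.hasDerivAt_eq_zero hder.self_of_nhds
  have hv : v r = -σ := by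
    rcases mul_eq_zero.1 heq with h | h
    · exact absurd h hεne
    · linarith
  have hv' : deriv v r = 0 := by
    rcases mul_eq_zero.1 (neg_eq_zero.1 h2) with h | h
    · exact absurd h hεne
    · exact h
  have h3 := P.eq_v r hr
  rw [hv, hv', zero_div, add_zero] at h3
  have h4 : 0 < ε * deriv (deriv v) r := by
    rw [h3]; unfold gRed
    have : ε * (γ * ((-σ + β) * (u r ^ 2 - 3 * σ ^ 2)
        + (-σ + σ) * ((-σ) ^ 2 - (β + σ) * -σ + 3 * β * σ)))
        = γ * ((ε * (σ - β)) * (3 * σ ^ 2 - u r ^ 2)) := by ring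
    rw [this]
    exact mul_pos P.γ_pos (mul_pos hd (sub_pos.2 (P.u_sq_lt hr)))
  linarith

/-- The strict bound at the centre: if `ε v` attained its boundary value at `0`, it would be
strictly subharmonic near `0` (where `u` is small), hence nondecreasing there. -/
lemma sign_mul_add_lt_zero (P : ReducedProfile R κ γ σ β τ u v) {ε : ℝ} (hε : ε = 1 ∨ ε = -1)
    (hd : 0 < ε * (σ - β)) : ε * (v 0 + σ) < 0 := by
  have hlt := P.sign_mul_add_lt hε hd
  obtain ⟨S, hS⟩ := exists_mem_interval P.R_pos
  have hcv : ContinuousWithinAt (fun r => ε * (v r + σ)) (Set.Ici 0) 0 :=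
    continuousWithinAt_const.mul (P.deriv_v_zero.continuousWithinAt.add continuousWithinAt_const)
  have hεne : ε ≠ 0 := by rcases hε with rfl | rfl <;> norm_num
  by_contra! hge
  have hle0 : ε * (v 0 + σ) ≤ 0 := by
    refine le_of_tendsto (hcv.mono_left (nhdsWithin_mono _ Set.Ioi_subset_Ici_self)) ?_
    filter_upwards [Ioo_mem_nhdsGT hS.1] with r hr
    exact (hlt r (interval_of_le hS hr.1 hr.2.le)).le
  have heq : ε * (v 0 + σ) = 0 := le_antisymm hle0 hge
  have hv0 : v 0 = -σ := by
    rcases mul_eq_zero.1 heq with h | h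
    · exact absurd h hεne
    · linarith
  have hG0 : 0 < ε * gRed γ σ β (v 0) (u 0) := by
    rw [hv0, P.u_zero]; unfold gRed
    have : ε * (γ * ((-σ + β) * ((0 : ℝ) ^ 2 - 3 * σ ^ 2)
        + (-σ + σ) * ((-σ) ^ 2 - (β + σ) * -σ + 3 * β * σ)))
        = γ * ((ε * (σ - β)) * (3 * σ ^ 2)) := by ring
    rw [this]
    have := P.σ_pos
    exact mul_pos P.γ_pos (mul_pos hd (by positivity))
  have hcG : ContinuousWithinAt (fun r => ε * gRed γ σ β (v r) (u r)) (Set.Ici 0) 0 := by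
    have hG : Continuous fun x : ℝ × ℝ => ε * gRed γ σ β x.1 x.2 := by unfold gRed; fun_prop
    exact hG.continuousAt.comp_continuousWithinAt
      (P.deriv_v_zero.continuousWithinAt.prodMk P.cont_u)
  obtain ⟨δ0, hδ0, hδG⟩ := (mem_nhdsGE_iff_exists_Ico_subset' hS.1).1
    (hcG.eventually (lt_mem_nhds hG0))
  have hδ0' : 0 < δ0 := hδ0
  set δ := min δ0 S
  have hδ : 0 < δ := lt_min hδ0' hS.1
  have hI : ∀ r ∈ Set.Ioo 0 δ, r ∈ interval R := fun r hr =>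
    interval_of_le hS hr.1 (hr.2.le.trans (min_le_right _ _))
  have hder : ∀ r ∈ interval R, HasDerivAt (fun r => ε * (v r + σ)) (ε * deriv v r) r :=
    fun r hr => ((P.diff_v r hr).hasDerivAt.add_const σ).const_mul ε
  have hmono := deriv_nonneg_of_radial_subharmonic (ε := δ) (fun r hr => hder r (hI r hr))
    (fun r hr => (P.diff_deriv_v r (hI r hr)).hasDerivAt.const_mul ε) hcv (fun r hr => by
      have : 0 < ε * gRed γ σ β (v r) (u r) := hδG ⟨hr.1.le, hr.2.trans_le (min_le_left _ _)⟩
      rw [← P.eq_v r (hI r hr)] at this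
      calc (0 : ℝ) ≤ _ := this.le
        _ = _ := by ring)
  have hmon : MonotoneOn (fun r => ε * (v r + σ)) (Set.Ico 0 δ) := by
    refine monotoneOn_of_deriv_nonneg (convex_Ico _ _) ?_ ?_ ?_
    · exact (continuousOn_Icc_of_mem_interval (fun r hr => (hder r hr).continuousAt) hcv hS).mono
        fun r hr => ⟨hr.1, hr.2.le.trans (min_le_right _ _)⟩
    · intro r hr
      rw [interior_Ico] at hr
      exact (hder r (hI r hr)).differentiableAt.differentiableWithinAt
    · intro r hr
      rw [interior_Ico] at hr
      rw [(hder r (hI r hr)).deriv]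
      exact hmono r hr
  have hm : δ / 2 ∈ Set.Ioo 0 δ := ⟨by linarith, by linarith⟩
  have h1 := hmon ⟨le_rfl, hδ⟩ ⟨hm.1.le, hm.2⟩ hm.1.le
  have h2 := hlt _ (hI _ hm)
  simp only at h1
  linarith

/-! ### The cooperative structure of the two regimes -/

lemma exists_forall_pos_near_end (P : ReducedProfile R κ γ σ β τ u v)
    {Q : (ℝ × ℝ) × (ℝ × ℝ) → ℝ} (hQ : Continuous Q) (h : 0 < Q ((τ, -σ), (τ, -σ))) :
    ∃ S ∈ interval R, ∀ a ∈ interval R, ∀ b ∈ interval R, S < a → S < b →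
      0 < Q ((u a, v a), (u b, v b)) := by
  have h1 := P.u_lim.prodMk_nhds P.v_lim
  have h2 := (hQ.tendsto _).comp ((h1.comp tendsto_fst).prodMk_nhds (h1.comp tendsto_snd))
  obtain ⟨t, ht, hpos⟩ := eventually_prod_self_iff'.1 (h2.eventually (lt_mem_nhds h))
  obtain ⟨S, hS, hSt⟩ := exists_of_eventually_endFilter P.R_pos ht
  exact ⟨S, hS, fun a ha b hb hSa hSb => hpos a (hSt a ha hSa) b (hSt b hb hSb)⟩

lemma neg_two_mul_le_v (P : ReducedProfile R κ γ σ β τ u v) {r : ℝ} (hr : r ∈ interval R) :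
    -(2 * σ) ≤ v r := by
  have h := P.sq_add_sq_le r hr
  have := P.σ_pos
  nlinarith [sq_nonneg (u r)]

lemma coopComponent_u (P : ReducedProfile R κ γ σ β τ u v) {ε : ℝ} (hε : ε = 1 ∨ ε = -1)
    (hd : 0 < ε * (σ - β)) :
    CoopComponent R κ (fun p z => hRed γ σ β p (ε * z)) u (fun r => ε * v r) τ τ
      ((2 + ε) * σ) where
  diff := P.diff_u
  diff_deriv := P.diff_deriv_u
  eq r hr := by
    have : ε * (ε * v r) = v r := by rcases hε with rfl | rfl <;> ring
    rw [P.eq_u r hr, this]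
  coeff_nonneg := P.κ_pos.le
  mul_nonneg r hr := (mul_pos P.κ_pos (P.u_pos r hr)).le
  cont_zero := P.cont_u
  centre := Or.inl fun r hr => by rw [P.u_zero]; exact P.u_pos r hr
  lim := P.u_lim
  lt_zero := by rw [P.u_zero]; exact P.τ_pos
  lt := P.u_lt
  anti a ha b hb c hc hcb := by
    have hεε : ∀ x : ℝ, ε * (ε * x) = x := fun x => by rcases hε with rfl | rfl <;> ring
    have h1 := P.sign_mul_add_lt hε hd b hb
    have h2 := P.sign_mul_add_lt hε hd c hc
    simp only [hεε]
    have e : hRed γ σ β (u a) (v c) - hRed γ σ β (u a) (v b)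
        = γ * u a * ((v b - v c) * -(v b + v c + 2 * β)) := by unfold hRed; ring
    have h3 : 0 ≤ (v b - v c) * -(v b + v c + 2 * β) := by
      have h4 : 0 ≤ (ε * (v b - v c)) * (ε * -(v b + v c + 2 * β)) :=
        mul_nonneg (by linarith) (by linarith)
      have h5 : (ε * (v b - v c)) * (ε * -(v b + v c + 2 * β))
          = (v b - v c) * -(v b + v c + 2 * β) := by rcases hε with rfl | rfl <;> ring
      rwa [h5] at h4
    have h6 := mul_nonneg (mul_nonneg P.γ_pos.le (P.u_pos a ha).le) h3
    linarith
  lip := by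
    have hγ := P.γ_pos
    have hσ := P.σ_pos
    have hβ := P.β_pos
    refine ⟨γ * (10 * σ ^ 2 + 2 * β * σ), by positivity, fun a ha b hb c hc hba => ?_⟩
    have hεε : ∀ x : ℝ, ε * (ε * x) = x := fun x => by rcases hε with rfl | rfl <;> ring
    simp only [hεε]
    have e : hRed γ σ β (u a) (v c) - hRed γ σ β (u b) (v c)
        = γ * (u a ^ 2 + u a * u b + u b ^ 2 - 3 * σ ^ 2 + (v c + σ) * (v c - σ + 2 * β))
          * (u a - u b) := by unfold hRed; ring
    rw [e]
    refine mul_le_mul_of_nonneg_right (mul_le_mul_of_nonneg_left ?_ hγ.le) (by linarith)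
    have h1 := P.u_sq_lt ha
    have h2 := P.u_sq_lt hb
    have h3 := P.sq_add_sq_le c hc
    have h4 := mul_pos hβ (neg_pos.2 (P.v_neg c hc))
    nlinarith [sq_nonneg (u a - u b), sq_nonneg (u c), sq_nonneg σ]
  pos_weight := P.τ_pos
  end_neg := by
    have hσ := P.σ_pos
    have hβ := P.β_pos
    obtain ⟨S, hS, h⟩ := P.exists_forall_pos_near_end
      (Q := fun x => τ * (x.1.1 ^ 2 + x.1.1 * x.2.1 + x.2.1 ^ 2 - 3 * σ ^ 2
          + (x.2.2 + σ) * (x.2.2 - σ + 2 * β))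
        + (2 + ε) * σ * (ε * (x.1.1 * (x.1.2 + x.2.2 + 2 * β)))) (by fun_prop) (by
        have e : τ * (τ ^ 2 + τ * τ + τ ^ 2 - 3 * σ ^ 2 + (-σ + σ) * (-σ - σ + 2 * β))
            + (2 + ε) * σ * (ε * (τ * (-σ + -σ + 2 * β)))
            = τ * (3 * τ ^ 2 - 3 * σ ^ 2 - (2 + ε) * σ * (2 * (ε * (σ - β)))) := by ring
        simp only
        rw [e, P.τ_sq]
        refine mul_pos P.τ_pos ?_
        have := P.β_le
        rcases hε with rfl | rfl <;> nlinarith)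
    refine ⟨S, hS, fun a ha b hb hSa hSb δ hδ hfab hgab => ?_⟩
    have hQ := h a ha b hb hSa hSb
    simp only at hQ hgab
    have hεε : ∀ x : ℝ, ε * (ε * x) = x := fun x => by rcases hε with rfl | rfl <;> ring
    simp only [hεε]
    have h1 := P.sign_mul_add_lt hε hd a ha
    have h2 := P.sign_mul_add_lt hε hd b hb
    have hY : ε * (u a * (v a + v b + 2 * β)) ≤ 0 := by
      rw [mul_left_comm]
      exact mul_nonpos_of_nonneg_of_nonpos (P.u_pos a ha).le (by linarith)
    have e : hRed γ σ β (u a) (v a) - hRed γ σ β (u b) (v b)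
        = γ * ((u a - u b) * (u a ^ 2 + u a * u b + u b ^ 2 - 3 * σ ^ 2
          + (v b + σ) * (v b - σ + 2 * β))
          + (ε * v a - ε * v b) * (ε * (u a * (v a + v b + 2 * β)))) := by
      unfold hRed
      rcases hε with rfl | rfl <;> ring
    have h3 := mul_le_mul_of_nonpos_right hgab hY
    have h4 := mul_pos hδ hQ
    rw [hfab] at e
    have h5 : γ * (-(δ * τ) * (u a ^ 2 + u a * u b + u b ^ 2 - 3 * σ ^ 2
          + (v b + σ) * (v b - σ + 2 * β))
          + (ε * v a - ε * v b) * (ε * (u a * (v a + v b + 2 * β)))) < 0 :=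
      mul_neg_of_pos_of_neg P.γ_pos (by linarith)
    linarith

lemma coopComponent_v (P : ReducedProfile R κ γ σ β τ u v) {ε : ℝ} (hε : ε = 1 ∨ ε = -1)
    (hd : 0 < ε * (σ - β)) :
    CoopComponent R 0 (fun z p => ε * gRed γ σ β (ε * z) p) (fun r => ε * v r) u (-(ε * σ))
      ((2 + ε) * σ) τ where
  diff r hr := (P.diff_v r hr).const_mul ε
  diff_deriv r hr := by
    have : deriv (fun r => ε * v r) = fun r => ε * deriv v r := funext fun _ =>
      deriv_const_mul_field _
    rw [this]
    exact (P.diff_deriv_v r hr).const_mul ε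
  eq r hr := by
    have h1 : deriv (fun r => ε * v r) = fun r => ε * deriv v r := funext fun _ =>
      deriv_const_mul_field _
    have h2 : ε * (ε * v r) = v r := by rcases hε with rfl | rfl <;> ring
    rw [h1, deriv_const_mul_field, h2, ← P.eq_v r hr]
    ring
  coeff_nonneg := le_rfl
  mul_nonneg r hr := by simp
  cont_zero := continuousWithinAt_const.mul P.deriv_v_zero.continuousWithinAt
  centre := Or.inr (by simpa using P.deriv_v_zero.const_mul ε)
  lim := by simpa using P.v_lim.const_mul ε
  lt_zero := by linarith [P.sign_mul_add_lt_zero hε hd]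
  lt r hr := by linarith [P.sign_mul_add_lt hε hd r hr]
  anti a ha b hb c hc hcb := by
    have hεε : ∀ x : ℝ, ε * (ε * x) = x := fun x => by rcases hε with rfl | rfl <;> ring
    have h1 := P.sign_mul_add_lt hε hd a ha
    simp only [hεε]
    have e : ε * gRed γ σ β (v a) (u c) - ε * gRed γ σ β (v a) (u b)
        = γ * (-(ε * (v a + β)) * ((u b - u c) * (u b + u c))) := by unfold gRed; ring
    have h2 : 0 ≤ (u b - u c) * (u b + u c) :=
      mul_nonneg (by linarith) (by linarith [P.u_pos b hb, P.u_pos c hc])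
    have h3 := mul_nonneg P.γ_pos.le (mul_nonneg (show 0 ≤ -(ε * (v a + β)) by linarith) h2)
    linarith
  lip := by
    have hγ := P.γ_pos
    have hσ := P.σ_pos
    have hβ := P.β_pos
    refine ⟨γ * (12 * σ ^ 2 + 6 * β * σ), by positivity, fun a ha b hb c hc hba => ?_⟩
    have hεε : ∀ x : ℝ, ε * (ε * x) = x := fun x => by rcases hε with rfl | rfl <;> ring
    simp only [hεε]
    have e : ε * gRed γ σ β (v a) (u c) - ε * gRed γ σ β (v b) (u c)
        = γ * (u c ^ 2 - 3 * σ ^ 2 + (v a ^ 2 + v a * v b + v b ^ 2) - β * (v a + v b)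
          + 2 * β * σ - σ ^ 2) * (ε * v a - ε * v b) := by unfold gRed; ring
    rw [e]
    refine mul_le_mul_of_nonneg_right (mul_le_mul_of_nonneg_left ?_ hγ.le) (by linarith)
    have h1 := P.u_sq_lt hc
    have h2 := P.sq_add_sq_le a ha
    have h3 := P.sq_add_sq_le b hb
    have h4 := mul_nonneg hβ.le (by linarith [P.neg_two_mul_le_v ha] : 0 ≤ v a + 2 * σ)
    have h5 := mul_nonneg hβ.le (by linarith [P.neg_two_mul_le_v hb] : 0 ≤ v b + 2 * σ)
    nlinarith [sq_nonneg (v a - v b), sq_nonneg (u a), sq_nonneg (u b), sq_nonneg σ]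
  pos_weight := by
    have := P.σ_pos
    rcases hε with rfl | rfl <;> linarith
  end_neg := by
    have hσ := P.σ_pos
    have hβ := P.β_pos
    obtain ⟨S, hS, h⟩ := P.exists_forall_pos_near_end
      (Q := fun x => (2 + ε) * σ * (x.2.1 ^ 2 - 3 * σ ^ 2
          + (x.1.2 ^ 2 + x.1.2 * x.2.2 + x.2.2 ^ 2) - β * (x.1.2 + x.2.2) + 2 * β * σ - σ ^ 2)
        + τ * (ε * (x.1.2 + β) * (x.1.1 + x.2.1))) (by fun_prop) (by
        have e : (2 + ε) * σ * (τ ^ 2 - 3 * σ ^ 2 + ((-σ) ^ 2 + -σ * -σ + (-σ) ^ 2)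
            - β * (-σ + -σ) + 2 * β * σ - σ ^ 2) + τ * (ε * (-σ + β) * (τ + τ))
            = (2 + ε) * σ * (τ ^ 2 - σ ^ 2 + 4 * β * σ) - 2 * τ ^ 2 * (ε * (σ - β)) := by ring
        simp only
        rw [e, P.τ_sq]
        have h1 := P.β_le
        have h2 : 0 < σ ^ 2 * β := by positivity
        have h3 : 0 < σ ^ 2 * (4 * σ - β) := mul_pos (by positivity) (by linarith)
        rcases hε with rfl | rfl <;> nlinarith)
    refine ⟨S, hS, fun a ha b hb hSa hSb δ hδ hfab hgab => ?_⟩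
    have hQ := h a ha b hb hSa hSb
    simp only at hQ hfab
    have hεε : ∀ x : ℝ, ε * (ε * x) = x := fun x => by rcases hε with rfl | rfl <;> ring
    simp only [hεε]
    have h1 := P.sign_mul_add_lt hε hd a ha
    have hY : ε * (v a + β) * (u a + u b) ≤ 0 :=
      mul_nonpos_of_nonpos_of_nonneg (by linarith) (by linarith [P.u_pos a ha, P.u_pos b hb])
    have e : ε * gRed γ σ β (v a) (u a) - ε * gRed γ σ β (v b) (u b)
        = γ * ((ε * v a - ε * v b) * (u b ^ 2 - 3 * σ ^ 2
          + (v a ^ 2 + v a * v b + v b ^ 2) - β * (v a + v b) + 2 * β * σ - σ ^ 2)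
          + (u a - u b) * (ε * (v a + β) * (u a + u b))) := by
      unfold gRed; ring
    have h3 := mul_le_mul_of_nonpos_right hgab hY
    have h4 := mul_pos hδ hQ
    rw [hfab] at e
    have h5 : γ * (-(δ * ((2 + ε) * σ)) * (u b ^ 2 - 3 * σ ^ 2
          + (v a ^ 2 + v a * v b + v b ^ 2) - β * (v a + v b) + 2 * β * σ - σ ^ 2)
          + (u a - u b) * (ε * (v a + β) * (u a + u b))) < 0 :=
      mul_neg_of_pos_of_neg P.γ_pos (by linarith)
    linarith

lemma v_eq_of_eq (P : ReducedProfile R κ γ σ β τ u v) (h : β = σ) :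
    ∀ r ∈ interval R, v r = -σ := by
  intro r hr
  have h1 := P.sign_mul_add_le (Or.inl rfl) (by simp [h]) r hr
  have h2 := P.sign_mul_add_le (Or.inr rfl) (by simp [h]) r hr
  linarith

/-- For `β = σ` the first equation decouples; it is regarded as a cooperative pair with two equal
components. -/
lemma coopComponent_of_eq (P : ReducedProfile R κ γ σ β τ u v) (h : β = σ) :
    CoopComponent R κ (fun p _ => γ * (p * (p ^ 2 - 3 * σ ^ 2))) u u τ 1 1 where
  diff := P.diff_u
  diff_deriv := P.diff_deriv_u
  eq r hr := by
    rw [P.eq_u r hr, P.v_eq_of_eq h r hr]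
    unfold hRed; ring
  coeff_nonneg := P.κ_pos.le
  mul_nonneg r hr := (mul_pos P.κ_pos (P.u_pos r hr)).le
  cont_zero := P.cont_u
  centre := Or.inl fun r hr => by rw [P.u_zero]; exact P.u_pos r hr
  lim := P.u_lim
  lt_zero := by rw [P.u_zero]; exact P.τ_pos
  lt := P.u_lt
  anti _ _ _ _ _ _ _ := le_rfl
  lip := by
    have hγ := P.γ_pos
    refine ⟨γ * (6 * σ ^ 2), by positivity, fun a ha b hb c hc hba => ?_⟩
    have e : γ * (u a * (u a ^ 2 - 3 * σ ^ 2)) - γ * (u b * (u b ^ 2 - 3 * σ ^ 2))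
        = γ * (u a ^ 2 + u a * u b + u b ^ 2 - 3 * σ ^ 2) * (u a - u b) := by ring
    rw [e]
    refine mul_le_mul_of_nonneg_right (mul_le_mul_of_nonneg_left ?_ hγ.le) (by linarith)
    have h1 := P.u_sq_lt ha
    have h2 := P.u_sq_lt hb
    nlinarith [sq_nonneg (u a - u b)]
  pos_weight := one_pos
  end_neg := by
    have hσ := P.σ_pos
    obtain ⟨S, hS, h⟩ := P.exists_forall_pos_near_end
      (Q := fun x => x.1.1 ^ 2 + x.1.1 * x.2.1 + x.2.1 ^ 2 - 3 * σ ^ 2) (by fun_prop) (by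
        have e : τ ^ 2 + τ * τ + τ ^ 2 - 3 * σ ^ 2 = 3 * τ ^ 2 - 3 * σ ^ 2 := by ring
        simp only
        rw [e, P.τ_sq]
        have : 0 < σ ^ 2 := by positivity
        linarith)
    refine ⟨S, hS, fun a ha b hb hSa hSb δ hδ hfab _ => ?_⟩
    have hQ := h a ha b hb hSa hSb
    have e : γ * (u a * (u a ^ 2 - 3 * σ ^ 2)) - γ * (u b * (u b ^ 2 - 3 * σ ^ 2))
        = γ * ((u a - u b) * (u a ^ 2 + u a * u b + u b ^ 2 - 3 * σ ^ 2)) := by ring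
    have h5 : γ * ((u a - u b) * (u a ^ 2 + u a * u b + u b ^ 2 - 3 * σ ^ 2)) < 0 :=
      mul_neg_of_pos_of_neg P.γ_pos (mul_neg_of_neg_of_pos (by linarith) hQ)
    linarith

lemma deriv_pos_of_sign (P : ReducedProfile R κ γ σ β τ u v) {ε : ℝ} (hε : ε = 1 ∨ ε = -1)
    (hd : 0 < ε * (σ - β)) : ∀ r ∈ interval R, 0 < deriv u r ∧ 0 < ε * deriv v r := by
  intro r hr
  have := deriv_pos_of_coopComponent P.R_pos (P.coopComponent_u hε hd) (P.coopComponent_v hε hd)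
    r hr
  rwa [deriv_const_mul_field] at this

lemma deriv_u_pos (P : ReducedProfile R κ γ σ β τ u v) :
    ∀ r ∈ interval R, 0 < deriv u r := by
  intro r hr
  rcases lt_trichotomy β σ with h | h | h
  · exact (P.deriv_pos_of_sign (Or.inl rfl) (by linarith) r hr).1
  · exact (deriv_pos_of_coopComponent P.R_pos (P.coopComponent_of_eq h) (P.coopComponent_of_eq h)
      r hr).1
  · exact (P.deriv_pos_of_sign (Or.inr rfl) (by linarith) r hr).1

end ReducedProfile

/-! ### Passage to the reduced parameters -/

lemma sq_eq_of_reduced {a b c : ℝ} (hc : 0 < c ^ 2) :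
    b ^ 2 = Real.sqrt 6 * (b ^ 2 / (Real.sqrt 6 * c ^ 2)) * c ^ 2 ∧
    a ^ 2 = c ^ 2 * (4 * (sPlus a b c / Real.sqrt 6) ^ 2
      - 2 * (b ^ 2 / (Real.sqrt 6 * c ^ 2)) * (sPlus a b c / Real.sqrt 6)) := by
  have h6 : Real.sqrt 6 ^ 2 = 6 := Real.sq_sqrt (by norm_num)
  have h60 : Real.sqrt 6 ≠ 0 := by positivity
  have hc0 : c ≠ 0 := by rintro rfl; simp at hc
  refine ⟨by field_simp, ?_⟩
  have hs : 2 * c ^ 2 * sPlus a b c ^ 2 - b ^ 2 * sPlus a b c = 3 * a ^ 2 := by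
    have hD : Real.sqrt (b ^ 4 + 24 * a ^ 2 * c ^ 2) ^ 2 = b ^ 4 + 24 * a ^ 2 * c ^ 2 :=
      Real.sq_sqrt (by positivity)
    unfold sPlus
    generalize Real.sqrt (b ^ 4 + 24 * a ^ 2 * c ^ 2) = D at hD
    field_simp
    linear_combination 2 * hD
  have e : c ^ 2 * (4 * (sPlus a b c / Real.sqrt 6) ^ 2
      - 2 * (b ^ 2 / (Real.sqrt 6 * c ^ 2)) * (sPlus a b c / Real.sqrt 6))
      = (4 * c ^ 2 * sPlus a b c ^ 2 - 2 * b ^ 2 * sPlus a b c) / Real.sqrt 6 ^ 2 := by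
    field_simp
  rw [e, h6]
  linarith

lemma reducedProfile {a b c : ℝ} (hb : 0 < b ^ 2) (hc : 0 < c ^ 2) {k : ℤ} (hk : k ≠ 0)
    {R : EReal} (hR : 0 < R) {u v : ℝ → ℝ} (hsol : IsSolution a b c k R u v)
    (hbc : BoundaryConditions a b c R u v) (hu : ∀ r ∈ interval R, 0 < u r)
    (hv : ∀ r ∈ interval R, v r < 0) :
    ReducedProfile R ((k : ℝ) ^ 2) (c ^ 2) (sPlus a b c / Real.sqrt 6)
      (b ^ 2 / (Real.sqrt 6 * c ^ 2)) (1 / Real.sqrt 2 * sPlus a b c) u v := by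
  have h6 : Real.sqrt 6 ^ 2 = 6 := Real.sq_sqrt (by norm_num)
  have h2 : Real.sqrt 2 ^ 2 = 2 := Real.sq_sqrt (by norm_num)
  have h60 : 0 < Real.sqrt 6 := by positivity
  have hc0 : c ≠ 0 := by rintro rfl; simp at hc
  have hs0 : 0 < sPlus a b c := by unfold sPlus; positivity
  have h23 : Real.sqrt (2 / 3) = 2 / Real.sqrt 6 := by
    rw [Real.sqrt_eq_iff_mul_self_eq (by norm_num) (by positivity), div_mul_div_comm,
      ← pow_two (Real.sqrt 6), h6]
    norm_num
  obtain ⟨hb2, ha2⟩ := sq_eq_of_reduced (a := a) (b := b) hc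
  have hk0 : (0 : ℝ) < (k : ℝ) ^ 2 := by
    have : (k : ℝ) ≠ 0 := by exact_mod_cast hk
    positivity
  have hβpos : 0 < b ^ 2 / (Real.sqrt 6 * c ^ 2) := by positivity
  have hσpos : 0 < sPlus a b c / Real.sqrt 6 := by positivity
  have hτ : (1 / Real.sqrt 2 * sPlus a b c) ^ 2 = 3 * (sPlus a b c / Real.sqrt 6) ^ 2 := by
    rw [mul_pow, div_pow, div_pow, h2, h6]; ring
  have hlimv : -(1 / Real.sqrt 6) * sPlus a b c = -(sPlus a b c / Real.sqrt 6) := by ring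
  have hvl := hbc.v_end
  rw [hlimv] at hvl
  have hτpos : 0 < 1 / Real.sqrt 2 * sPlus a b c := by positivity
  have hle : b ^ 2 / (Real.sqrt 6 * c ^ 2) ≤ 2 * (sPlus a b c / Real.sqrt 6) := by
    by_contra! hlt
    have h1 : c ^ 2 * (2 * (sPlus a b c / Real.sqrt 6) *
        (b ^ 2 / (Real.sqrt 6 * c ^ 2) - 2 * (sPlus a b c / Real.sqrt 6))) > 0 :=
      mul_pos hc (mul_pos (by linarith) (by linarith))
    nlinarith [sq_nonneg a]
  have hh : ∀ p q, hFun a b c p q = hRed (c ^ 2) (sPlus a b c / Real.sqrt 6)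
      (b ^ 2 / (Real.sqrt 6 * c ^ 2)) p q := by
    intro p q
    unfold hFun hRed
    rw [ha2, h23]
    have : 2 / Real.sqrt 6 * b ^ 2 = 2 * (b ^ 2 / (Real.sqrt 6 * c ^ 2)) * c ^ 2 := by
      field_simp
    rw [this]
    ring
  have hg : ∀ p q, gFun a b c p q = gRed (c ^ 2) (sPlus a b c / Real.sqrt 6)
      (b ^ 2 / (Real.sqrt 6 * c ^ 2)) q p := by
    intro p q
    unfold gFun gRed
    rw [ha2]
    have : 1 / Real.sqrt 6 * b ^ 2 = b ^ 2 / (Real.sqrt 6 * c ^ 2) * c ^ 2 := by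
      field_simp
    rw [this]
    ring
  exact
    { R_pos := hR
      κ_pos := hk0
      γ_pos := hc
      σ_pos := hσpos
      β_pos := hβpos
      β_le := hle
      τ_pos := hτpos
      τ_sq := hτ
      diff_u := hsol.diff_u
      diff_v := hsol.diff_v
      diff_deriv_u := hsol.diff_deriv_u
      diff_deriv_v := hsol.diff_deriv_v
      eq_u := fun r hr => by rw [← hh]; exact hsol.eq_u r hr
      eq_v := fun r hr => by rw [← hg]; exact hsol.eq_v r hr
      u_zero := hbc.u_zero
      cont_u := hbc.cont_u_zero
      deriv_v_zero := hbc.deriv_v_zero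
      u_lim := hbc.u_end
      v_lim := hvl
      u_pos := hu
      v_neg := hv }

/-- The sign of `3 a² c² - b⁴` is that of `σ - β`. -/
lemma discriminant_eq {a b c : ℝ} (hc : 0 < c ^ 2) :
    3 * a ^ 2 * c ^ 2 - b ^ 4 = (sPlus a b c / Real.sqrt 6 - b ^ 2 / (Real.sqrt 6 * c ^ 2)) *
      (6 * c ^ 4 * (2 * (sPlus a b c / Real.sqrt 6) + b ^ 2 / (Real.sqrt 6 * c ^ 2))) := by
  have h6 : Real.sqrt 6 ^ 2 = 6 := Real.sq_sqrt (by norm_num)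
  obtain ⟨hb2, ha2⟩ := sq_eq_of_reduced (a := a) (b := b) hc
  generalize sPlus a b c / Real.sqrt 6 = σ at *
  generalize b ^ 2 / (Real.sqrt 6 * c ^ 2) = β at *
  have hb4 : b ^ 4 = 6 * β ^ 2 * c ^ 4 := by
    calc b ^ 4 = (b ^ 2) ^ 2 := by ring
      _ = (Real.sqrt 6 * β * c ^ 2) ^ 2 := by rw [hb2]
      _ = Real.sqrt 6 ^ 2 * β ^ 2 * c ^ 4 := by ring
      _ = _ := by rw [h6]
  rw [hb4, ha2]
  ring

end LdG

end

theorem theorem1p3 (a b c : ℝ) (hb : 0 < b ^ 2) (hc : 0 < c ^ 2) (k : ℤ) (hk : k ≠ 0)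
    (R : EReal) (hR : 0 < R) (u v : ℝ → ℝ)
    (hsol : LdG.IsSolution a b c k R u v)
    (hbc : LdG.BoundaryConditions a b c R u v)
    (hu : ∀ r ∈ LdG.interval R, 0 < u r)
    (hv : ∀ r ∈ LdG.interval R, v r < 0) :
    (∀ r ∈ LdG.interval R, 0 < deriv u r) ∧
    (b ^ 4 < 3 * a ^ 2 * c ^ 2 → ∀ r ∈ LdG.interval R, 0 < deriv v r) ∧
    (b ^ 4 = 3 * a ^ 2 * c ^ 2 →
      ∀ r ∈ LdG.interval R, v r = -(LdG.sPlus a b c / Real.sqrt 6)) ∧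
    (3 * a ^ 2 * c ^ 2 < b ^ 4 → ∀ r ∈ LdG.interval R, deriv v r < 0) := by
  have P := LdG.reducedProfile hb hc hk hR hsol hbc hu hv
  have hdisc := LdG.discriminant_eq (a := a) (b := b) hc
  have hpos : 0 < 6 * c ^ 4 * (2 * (LdG.sPlus a b c / Real.sqrt 6)
      + b ^ 2 / (Real.sqrt 6 * c ^ 2)) := by
    have h1 := P.σ_pos
    have h2 := P.β_pos
    have h3 : 0 < c ^ 4 := by
      have := pow_pos hc 2
      rwa [← pow_mul] at this
    positivity
  refine ⟨P.deriv_u_pos, fun h r hr => ?_, fun h => P.v_eq_of_eq ?_, fun h r hr => ?_⟩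
  · have h1 := pos_of_mul_pos_left (hdisc ▸ sub_pos.2 h) hpos.le
    simpa using (P.deriv_pos_of_sign (Or.inl rfl) (by linarith) r hr).2
  · rw [← h, sub_self] at hdisc
    rcases mul_eq_zero.1 hdisc.symm with h1 | h1
    · linarith
    · exact absurd h1 hpos.ne'
  · have h1 := neg_of_mul_neg_left (hdisc ▸ sub_neg.2 h) hpos.le
    have := (P.deriv_pos_of_sign (Or.inr rfl) (by linarith) r hr).2
    linarith
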